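/- **Lie algebras and parabolics.** Work over $\mathbb C$. Let $J_N$ be the $N\times N$ matrix with ones on the skew diagonal and zeros elsewhere. Let $\mathfrak{so}_N=\{A: A^TJ_N+J_NA=0\}$ and $\mathfrak{sp}_{2n}=\{A: A^T\Omega+\Omega A=0\}$, where $\Omega=\begin{bmatrix}0&J_n\\-J_n&0\end{bmatrix}$. Let $d$ be a palindromic vector of positive integers with sum $N$ ($N=2n$ for $\mathfrak{sp}_{2n}$), of the form $(d_1,\dots,d_r,d_r,\dots,d_1)$ (type (a)) or $(d_1,\dots,d_r,d_{r+1},d_r,\dots,d_1)$ (type (b)). For $\mathfrak g=\mathfrak{sp}_{2n}$ or $\mathfrak{so}_N$ let $\mathfrak p(d)$, $\mathfrak m$, $\mathfrak n$ be the sets of block upper triangular, block diagonal and strictly block upper triangular matrices in $\mathfrak g$, with diagonal blocks of sizes $d$. An element $X\in\mathfrak n$ is a *Richardson element* for $\mathfrak p(d)$ if $[\mathfrak p(d),X]=\mathfrak n$. **Simple parabolics.** $\mathfrak p(d)$ is *simple* in the following cases. 1. $\mathfrak{sp}_{2n}$, type (a). 2. $\mathfrak{so}_{2n}$, type (a), if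 every odd block length appears exactly twice in $d$. 3. $\mathfrak{sp}_{2n}$, type (b), if every odd $d_i<d_{r+1}$ appears exactly twice in $d$. 4. $\mathfrak{so}_N$, type (b), if for some $0\le k\le r$ the numbers $d_1,\dots,d_k$ are even, $d_{k+1},\dots,d_r$ are odd, every even $d_i$ ($i\le k$) is smaller than each of $d_{k+1},\dots,d_r$, the even $d_i>d_{r+1}$ occur only once among $d_1,\dots,d_k$, and $d_{r+1}$ is odd unless $k=r$ (if $k=r$, its parity is arbitrary). **Diagrams.** A diagram is a set of lines on the vertices $1,\dots,N$. The vertices are arranged in columns of lengths given by $d$ and labelled consecutively column by column, top to bottom in the first $r$ columns (the *left* columns) and in the central column (type (b)). Write $k^*=N+1-k$. The counterpart of a line $i$—$j$ is $j^*$—$i^*$. All diagrams contain the counterparts of all their lines; "joining a sequence" means drawing a line between any two successive vertices. *$L_{even}(d)$ (type (a)).* Top-adjust the left columns, and in each row join its vertices from left to right; add counterparts. Let $e_\rho$ be the last vertex of row $\rho$ of the left half. * For $\mathfrak{sp}_{2n}$ add $e_\rho$—$e_\rho^*$ for all non-empty rows $\rho$. * For $\mathfrak{so}_{2n}$ add $e_{2l-1}$—$e_{2l}^*$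 and $e_{2l}$—$e_{2l-1}^*$ for all $l\geq 1$ such that rows $2l-1$ and $2l$ are both non-empty. *$L_{odd}(d)$ for $\mathfrak{sp}_{2n}$ (type (b)).* Proceed in rounds; after each round delete the topmost and the lowest remaining vertex of every column, until no vertices are left. In one round let $T$ be the sequence, from left to right, of the topmost remaining vertices of the non-exhausted left columns, and $B$ the sequence of the lowest remaining vertices of the left columns with at least two remaining vertices. Join the sequence $T$ and join the sequence $B$. Let $t,b$ be the last vertices of $T,B$; below, a line with an undefined end is omitted. * If the central column is not exhausted (it then has at least two remaining vertices), join $t$ to its topmost and $b$ to its lowest remaining vertex. * If it is exhausted and no left column has exactly one remaining vertex, add $t$—$b^*$ and $b$—$t^*$. * If it is exhausted and some left column has exactly one remaining vertex, add $t$—$t^*$ and $b$—$b^*$. Add all counterparts. *$L_{odd}(d)$ for $\mathfrak{so}_N$ (type (b)).* If $d_{r+1}$ is odd, first choose a sequence $S$ of vertices in left columns, from left to right. If no even $d_i$, $i\le r$, exceeds $d_{r+1}$, $S$ consists of the middle vertices of the left columns of odd length. Otherwise $S$ consists of the vertices in row $(d_{r+1}+1)/2$ of the left columns longer than $d_{r+1}$.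 Join the sequence $S$, join its last vertex to the middle vertex of the central column, add the counterparts, and remove from consideration the vertices of $S$, their images under ${}^*$ and the middle vertex of the central column. (If $d_{r+1}$ is even, skip this step.) On the remaining vertices proceed in rounds with $T,B,t,b$ as above: join $T$ and $B$; if the central column is not exhausted, join $t$ to its topmost and $b$ to its lowest remaining vertex; if it is exhausted, add $t$—$b^*$ and $b$—$t^*$ (no such line if $B$ is empty). Add all counterparts. **Theorem.** Let $\mathfrak p(d)$ be a simple parabolic subalgebra of $\mathfrak g=\mathfrak{sp}_{2n}$ or $\mathfrak{so}_N$. With the sums over all lines $i$—$j$, $i<j$, of $L_{even}(d)$ in type (a), resp. $L_{odd}(d)$ in type (b), put $$X(d)=\sum_{i\le n}E_{ij}-\sum_{i>n}E_{ij}\ \text{ for }\mathfrak{sp}_{2n},\qquad X(d)=\sum_{i+j\le N}E_{ij}-\sum_{i+j>N}E_{ij}\ \text{ for }\mathfrak{so}_N .$$ Then $X(d)$ is a Richardson element for $\mathfrak p(d)$, and $\dim\mathfrak g^{X(d)}=\dim\mathfrak m$, where $\mathfrak g^{X}=\{A\in\mathfrak g:[A,X]=0\}$. -/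

import Mathlib

namespace LineDiagram

attribute [local instance 100] LieRing.ofAssociativeRing

/-! ## Classical Lie algebras, standard parabolic subalgebras, Richardson elements -/

/-- The two families of classical Lie algebras considered: symplectic and orthogonal. -/
inductive Family
  | sp
  | so

/-- The matrix of the bilinear form on `ℂ^N`. Orthogonal: ones on the skew diagonal.
Symplectic (with `N = 2n`): the skew diagonal carries `1` in the first `n` rows and `-1` in the
last `n` rows. -/
def formMatrix (τ : Family) (N : ℕ) : Matrix (Fin N) (Fin N) ℂ :=
  Matrix.of fun a b =>
    if b = a.rev then
      (match τ with
        | .sp => if a.val < N / 2 then 1 else -1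
        | .so => 1)
    else 0

/-- The Lie algebra `sp_N` (for even `N`) resp. `so_N`: all `A` with `Aᵀ J + J A = 0`, where `J` is
the matrix of the form. -/
def classicalLie (τ : Family) (N : ℕ) : LieSubalgebra ℂ (Matrix (Fin N) (Fin N) ℂ) :=
  skewAdjointMatricesLieSubalgebra (formMatrix τ N)

/-- The number (from `0`) of the block of sizes `d = (d₁, d₂, …)` that contains the position `a`
(counted from `0`). -/
def blockIndex : List ℕ → ℕ → ℕ
  | [], _ => 0
  | x :: d, a => if a < x then 0 else blockIndex d (a - x) + 1

/-- The block number of a row or column index. -/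
def block (d : List ℕ) (a : Fin d.sum) : ℕ := blockIndex d a.val

/-- The standard parabolic subalgebra `p(d)`: the block upper triangular matrices in the Lie
algebra, with diagonal blocks of sizes `d`. -/
def parabolic (τ : Family) (d : List ℕ) :
    LieSubalgebra ℂ (Matrix (Fin d.sum) (Fin d.sum) ℂ) where
  carrier := {A | A ∈ classicalLie τ d.sum ∧ A.BlockTriangular (block d)}
  zero_mem' := ⟨zero_mem _, Matrix.blockTriangular_zero⟩
  add_mem' := fun hA hB => ⟨add_mem hA.1 hB.1, hA.2.add hB.2⟩
  smul_mem' := fun c A hA => ⟨(classicalLie τ d.sum).smul_mem c hA.1, fun a b h => by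
    simp [hA.2 h]⟩
  lie_mem' := fun {A B} hA hB => by
    refine ⟨(classicalLie τ d.sum).lie_mem hA.1 hB.1, ?_⟩
    rw [Ring.lie_def]
    exact (hA.2.mul hB.2).sub (hB.2.mul hA.2)

/-- The nilradical `n` of `p(d)`: its strictly block upper triangular matrices. -/
def nilradical (τ : Family) (d : List ℕ) :
    Submodule ℂ (Matrix (Fin d.sum) (Fin d.sum) ℂ) where
  carrier := {A | A ∈ classicalLie τ d.sum ∧ ∀ a b, block d b ≤ block d a → A a b = 0}
  zero_mem' := ⟨zero_mem _, fun _ _ _ => rfl⟩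
  add_mem' := fun hA hB => ⟨add_mem hA.1 hB.1, fun a b h => by
    simp [hA.2 a b h, hB.2 a b h]⟩
  smul_mem' := fun c A hA => ⟨(classicalLie τ d.sum).smul_mem c hA.1, fun a b h => by
    simp [hA.2 a b h]⟩

/-- The standard Levi factor `m` of `p(d)`: its block diagonal matrices. -/
def leviFactor (τ : Family) (d : List ℕ) :
    Submodule ℂ (Matrix (Fin d.sum) (Fin d.sum) ℂ) where
  carrier := {A | A ∈ classicalLie τ d.sum ∧ ∀ a b, block d a ≠ block d b → A a b = 0}
  zero_mem' := ⟨zero_mem _, fun _ _ _ => rfl⟩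
  add_mem' := fun hA hB => ⟨add_mem hA.1 hB.1, fun a b h => by
    simp [hA.2 a b h, hB.2 a b h]⟩
  smul_mem' := fun c A hA => ⟨(classicalLie τ d.sum).smul_mem c hA.1, fun a b h => by
    simp [hA.2 a b h]⟩

/-- The centralizer `g^X` of a matrix `X` in the Lie algebra `g`. -/
def centralizer (τ : Family) {N : ℕ} (X : Matrix (Fin N) (Fin N) ℂ) :
    Submodule ℂ (Matrix (Fin N) (Fin N) ℂ) where
  carrier := {A | A ∈ classicalLie τ N ∧ ⁅A, X⁆ = 0}
  zero_mem' := ⟨zero_mem _, zero_lie X⟩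
  add_mem' := fun hA hB => ⟨add_mem hA.1 hB.1, by rw [add_lie, hA.2, hB.2, add_zero]⟩
  smul_mem' := fun c A hA => ⟨(classicalLie τ N).smul_mem c hA.1, by
    rw [smul_lie, hA.2, smul_zero]⟩

/-- `X` is a Richardson element for `p(d) = m ⊕ n`: `X ∈ n` and `[p(d), X] = n`. -/
def IsRichardson (τ : Family) (d : List ℕ) (X : Matrix (Fin d.sum) (Fin d.sum) ℂ) : Prop :=
  X ∈ nilradical τ d ∧
    {Y | ∃ A ∈ parabolic τ d, ⁅A, X⁆ = Y} =
      (nilradical τ d : Set (Matrix (Fin d.sum) (Fin d.sum) ℂ))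

/-! ## Palindromic dimension vectors and simple parabolic subalgebras

A palindromic dimension vector is given by its left half `l = (d₁, …, d_r)` and its central entry:
`none` for `(d₁, …, d_r, d_r, …, d₁)` (type (a)), and `some c` for
`(d₁, …, d_r, c, d_r, …, d₁)` (type (b)). -/

/-- The dimension vector with left half `l` and central entry `c`. -/
def dimVector (l : List ℕ) (c : Option ℕ) : List ℕ := l ++ c.toList ++ l.reverse

/-- The condition that the parabolic subalgebra of the given dimension vector is simple:
* `sp`, type (a): no condition;
* `so`, type (a): odd block lengths appear exactly twice;
* `sp`, type (b): each odd block length smaller than `c` appears exactly twice (and `c` is even,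
  as the size of the matrices is);
* `so`, type (b): the left half consists of even lengths `e` followed by odd lengths `o`, the even
  ones smaller than these odd ones; an even length larger than `c` appears only once in `e`;
  and `c` is odd as well, unless there are no odd lengths on the left. -/
def IsSimple : Family → List ℕ → Option ℕ → Prop
  | .sp, _, none => True
  | .so, l, none =>
      ∀ x ∈ dimVector l none, Odd x → (dimVector l none).count x = 2
  | .sp, l, some c =>
      Even c ∧ ∀ x ∈ dimVector l (some c), Odd x → x < c → (dimVector l (some c)).count x = 2
  | .so, l, some c =>
      ∃ e o : List ℕ, l = e ++ o ∧ (∀ x ∈ e, Even x) ∧ (∀ x ∈ o, Odd x) ∧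
        (∀ x ∈ e, ∀ y ∈ o, x < y) ∧ (∀ x ∈ e, c < x → e.count x = 1) ∧ (Odd c ∨ o = [])

/-! ## Line diagrams

Vertices carry the labels `1, …, N`. A diagram is given by its chains: a chain is the increasing
list of the labels of vertices joined successively by lines (a list with at most one entry
contributes no line). -/

/-- Columns of the given lengths, labelled consecutively from `s`, from top to bottom. -/
def columns : ℕ → List ℕ → List (List ℕ)
  | _, [] => []
  | s, x :: l => List.range' s x :: columns (s + x) l

/-- The vertices in row `k` (counted from `0`) of top-adjusted columns, from left to right. -/
def row (C : List (List ℕ)) (k : ℕ) : List ℕ := C.filterMap fun v => v[k]?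

/-- The sequence of mirror images `k ↦ N + 1 - k` of a sequence of vertices, in reverse order; a
line `i — j` of the sequence becomes its counterpart `(N + 1 - j) — (N + 1 - i)`. -/
def mirror (N : ℕ) (S : List ℕ) : List ℕ := S.reverse.map fun k => N + 1 - k

/-- `L_even(d)`, symplectic case, `N = 2n`: the horizontal rows in the left half and their
counterparts, joined through the lines `k — (2n + 1 - k)` at the last vertex `k` of each row of the
left half. -/
def evenSp (l : List ℕ) : List (List ℕ) :=
  let N := 2 * l.sum
  (List.range N).map fun k => row (columns 1 l) k ++ mirror N (row (columns 1 l) k)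

/-- `L_even(d)`, orthogonal case, `N = 2n`: the horizontal rows in the left half and their
counterparts; the rows are taken in pairs from the top, and the last vertex of each row of a pair
is joined to the mirror image of the last vertex of the other one (if both rows are non-empty). -/
def evenSo (l : List ℕ) : List (List ℕ) :=
  let N := 2 * l.sum
  (List.range N).flatMap fun t =>
    let R := row (columns 1 l) (2 * t)
    let R' := row (columns 1 l) (2 * t + 1)
    [R ++ mirror N R', R' ++ mirror N R]

/-- The topmost vertices of the columns after `t` rounds, in each of which every column has lost its
topmost vertex and its lowest vertex. -/
def topmost (C : List (List ℕ)) (t : ℕ) : List ℕ :=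
  C.filterMap fun v => if 2 * t + 1 ≤ v.length then v[t]? else none

/-- The lowest vertices of the columns after `t` such rounds, for those columns that have at least
two vertices left. -/
def lowest (C : List (List ℕ)) (t : ℕ) : List ℕ :=
  C.filterMap fun v => if 2 * t + 2 ≤ v.length then v.reverse[t]? else none

/-- The chains through the central column `Z` (when it has at least two vertices left) drawn in
round `t`: topmost vertices on the left, topmost vertex of `Z`, topmost vertices on the right,
and the counterpart through the lowest vertices. -/
def throughCentre (N : ℕ) (C : List (List ℕ)) (Z : List ℕ) (t : ℕ) : List (List ℕ) :=
  [topmost C t ++ Z[t]?.toList ++ mirror N (lowest C t),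
    lowest C t ++ Z.reverse[t]?.toList ++ mirror N (topmost C t)]

/-- The same chains when the central column has no vertices left: topmost to topmost, and lowest
to lowest. If there is no lowest vertex on the left, then no line crosses the centre. -/
def acrossCentre (N : ℕ) (C : List (List ℕ)) (t : ℕ) : List (List ℕ) :=
  [topmost C t ++ mirror N (lowest C t), lowest C t ++ mirror N (topmost C t)]

/-- `L_odd(d)`, symplectic case: the columns are joined in rounds, topmost to topmost on the left of
the centre, and lowest to lowest, together with the counterparts. In a round in which the central column has no vertices left and
some other column has exactly one vertex left, the last topmost and the last lowest vertex `k` of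
the left half are joined to their own mirror images `N + 1 - k`. -/
def oddSp (l : List ℕ) (c : ℕ) : List (List ℕ) :=
  let N := 2 * l.sum + c
  let C := columns 1 l
  let Z := List.range' (l.sum + 1) c
  (List.range N).flatMap fun t =>
    if 2 * t + 2 ≤ c then throughCentre N C Z t
    else if ∃ x ∈ l, x = 2 * t + 1 then
      [topmost C t ++ mirror N (topmost C t), lowest C t ++ mirror N (lowest C t)]
    else acrossCentre N C t

/-- The rounds of the orthogonal case. -/
def oddSoRounds (N : ℕ) (C : List (List ℕ)) (Z : List ℕ) : List (List ℕ) :=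
  (List.range N).flatMap fun t =>
    if 2 * t + 2 ≤ Z.length then throughCentre N C Z t else acrossCentre N C t

/-- The row (counted from `0`) of the vertex of a left column of length `x` on the chain through the
middle vertex of a central column of odd length `c`. If no even length on the left exceeds
`c`, the chain joins the middle vertices of the columns of odd length; otherwise it runs through
the row of the middle vertex of the central column in all columns longer than `c`. -/
def spineRow (l : List ℕ) (c x : ℕ) : Option ℕ :=
  if ∃ y ∈ l, Even y ∧ c < y then (if c < x then some (c / 2) else none)
  else (if Odd x then some (x / 2) else none)

/-- The vertex of the left column `v` on that chain, if any. -/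
def spineVertex (l : List ℕ) (c : ℕ) (v : List ℕ) : Option ℕ :=
  (spineRow l c v.length).bind fun k => v[k]?

/-- The left column `v` without its vertex on that chain. -/
def offSpine (l : List ℕ) (c : ℕ) (v : List ℕ) : List ℕ :=
  match spineRow l c v.length with
  | some k => v.eraseIdx k
  | none => v

/-- `L_odd(d)`, orthogonal case. For odd `c` one chain, symmetric under `k ↦ N + 1 - k`, passes
through the middle vertex of the central column; the vertices off this chain are joined in rounds,
topmost to topmost and lowest to lowest. -/
def oddSo (l : List ℕ) (c : ℕ) : List (List ℕ) :=
  let N := 2 * l.sum + c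
  let C := columns 1 l
  let Z := List.range' (l.sum + 1) c
  if Odd c then
    let S := C.filterMap (spineVertex l c)
    (S ++ Z[c / 2]?.toList ++ mirror N S) ::
      oddSoRounds N (C.map (offSpine l c)) (Z.eraseIdx (c / 2))
  else oddSoRounds N C Z

/-- The chains of the line diagram associated to a dimension vector. -/
def chains : Family → List ℕ → Option ℕ → List (List ℕ)
  | .sp, l, none => evenSp l
  | .so, l, none => evenSo l
  | .sp, l, some c => oddSp l c
  | .so, l, some c => oddSo l c

/-- The lines `i — j` of the line diagram: pairs of successive vertices of a chain. -/
def diagramLines (τ : Family) (l : List ℕ) (c : Option ℕ) : List (ℕ × ℕ) :=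
  (chains τ l c).flatMap fun S => S.zip S.tail

/-- The sign of the line `i — j`: for `sp_N` with `N = 2n` it is `+` iff `i ≤ n`, and for
`so_N` it is `+` iff `i + j ≤ N`. -/
def lineSign (τ : Family) (N i j : ℕ) : ℂ :=
  match τ with
  | .sp => if i ≤ N / 2 then 1 else -1
  | .so => if i + j ≤ N then 1 else -1

/-- The matrix `X(d) = ∑ ± E_{ij}`, summed over the lines `i — j` of the diagram. -/
def lineMatrix (τ : Family) (l : List ℕ) (c : Option ℕ) :
    Matrix (Fin (dimVector l c).sum) (Fin (dimVector l c).sum) ℂ :=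
  Matrix.of fun a b =>
    if (a.val + 1, b.val + 1) ∈ diagramLines τ l c then
      lineSign τ (dimVector l c).sum (a.val + 1) (b.val + 1)
    else 0

end LineDiagram

/-!
Cut the vertices of the diagram into its chains. Then `X = X(d)` is, up to signs, the shift along
the chains, so `[A, X]` only compares consecutive entries of `A` along the diagonals of the
rectangles `chain k × chain k'`. After a change of signs the mirror image acts on matrices by a
permutation of the positions and a sign, and both the centralizer of `X` and the Levi factor become
spaces of functions on a finite set that are equivariant under an involution. The dimension of such
a space is half of the number of points plus half of the signed number of fixed points.

Counting diagonals in the rectangles bounds `dim g^X` by `dim m`: two chains that are nested as sets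
of columns contribute the length of the shorter one, which is also their contribution to the block
diagonal matrices. The contribution of a chain together with its mirror image is subtler, and it is
there that the conditions on a simple parabolic enter. Finally `dim p - dim n = dim m`, so the bound
forces `[p, X]`, which is contained in `n`, to be equal to it, and the bound to be an equality.
-/

namespace LineDiagram

attribute [local instance 100] LieRing.ofAssociativeRing

open Finset

/-! ## Equivariant functions -/

section Equivariant

variable {𝕜 X : Type*} [Field 𝕜]

/-- The functions that an involution `ι` multiplies by the weight `σ`. The entries of a matrix of
a classical Lie algebra form such a function, and so do the coordinates of a centralizer. -/
def equivariantFunctions (ι : X → X) (σ : X → 𝕜) : Submodule 𝕜 (X → 𝕜) where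
  carrier := {f | ∀ x, f (ι x) = σ x * f x}
  zero_mem' := fun _ => by simp
  add_mem' := fun hf hg x => by simp only [Pi.add_apply, hf x, hg x, mul_add]
  smul_mem' := fun c f hf x => by simp only [Pi.smul_apply, smul_eq_mul, hf x, mul_left_comm]

/-- The projection of all functions onto the equivariant ones. -/
def equivariantProjection (ι : X → X) (σ : X → 𝕜) : (X → 𝕜) →ₗ[𝕜] (X → 𝕜) where
  toFun f x := (f x + σ (ι x) * f (ι x)) / 2
  map_add' f g := by ext x; simp only [Pi.add_apply]; ring
  map_smul' c f := by ext x; simp only [Pi.smul_apply, smul_eq_mul, RingHom.id_apply]; ring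

variable [NeZero (2 : 𝕜)] {ι : X → X} {σ : X → 𝕜}

theorem isProj_equivariantProjection (hι : ι.Involutive) (hσ : ∀ x, σ (ι x) * σ x = 1) :
    LinearMap.IsProj (equivariantFunctions ι σ) (equivariantProjection ι σ) where
  map_mem f x := by
    simp only [equivariantProjection, LinearMap.coe_mk, AddHom.coe_mk, hι x]
    linear_combination (-(f (ι x)) / 2) * hσ x
  map_id f hf := by
    ext x
    have htwo : (2 : 𝕜) ≠ 0 := two_ne_zero
    simp only [equivariantProjection, LinearMap.coe_mk, AddHom.coe_mk, hf x]
    field_simp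
    linear_combination f x * hσ x

theorem two_mul_finrank_equivariantFunctions [Fintype X] [DecidableEq X] (hι : ι.Involutive)
    (hσ : ∀ x, σ (ι x) * σ x = 1) :
    2 * (Module.finrank 𝕜 (equivariantFunctions ι σ) : 𝕜) =
      Fintype.card X + ∑ x with ι x = x, σ x := by
  have htwo : (2 : 𝕜) ≠ 0 := two_ne_zero
  rw [← (isProj_equivariantProjection hι hσ).trace,
    LinearMap.trace_eq_matrix_trace 𝕜 (Pi.basisFun 𝕜 X), Matrix.trace, mul_sum,
    Fintype.card_eq_sum_ones, Nat.cast_sum, sum_filter, ← sum_add_distrib]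
  refine sum_congr rfl fun x _ => ?_
  simp only [Matrix.diag, LinearMap.toMatrix_apply, Pi.basisFun_apply, Pi.basisFun_repr,
    equivariantProjection, LinearMap.coe_mk, AddHom.coe_mk, mul_div_cancel₀ _ htwo]
  by_cases hx : ι x = x <;> simp [hx]

end Equivariant

/-! ## The classical Lie algebras in coordinates -/

/-- The entry of the form matrix in row `i` (on the skew diagonal). -/
def formSign (τ : Family) {N : ℕ} (i : Fin N) : ℂ :=
  match τ with
  | .sp => if i.val < N / 2 then 1 else -1
  | .so => 1

/-- The sign `ε` for which the bilinear form of the family is `-ε`-symmetric: `1` in the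
symplectic case, `-1` in the orthogonal case. -/
def familySign : Family → ℤ
  | .sp => 1
  | .so => -1

theorem familySign_mul_self (τ : Family) : familySign τ * familySign τ = 1 := by
  cases τ <;> rfl

theorem formSign_mul_self (τ : Family) {N : ℕ} (i : Fin N) :
    formSign τ i * formSign τ i = 1 := by
  cases τ
  · unfold formSign; split_ifs <;> simp
  · simp [formSign]

theorem formSign_rev {τ : Family} {N : ℕ} (hN : τ = .sp → Even N) (i : Fin N) :
    formSign τ i.rev = -familySign τ * formSign τ i := by
  cases τ
  · obtain ⟨m, hm⟩ := hN rfl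
    have hrev : i.rev.val < N / 2 ↔ ¬ i.val < N / 2 := by rw [Fin.val_rev]; omega
    simp only [formSign, familySign, hrev]
    by_cases h : i.val < N / 2 <;> simp [h]
  · simp [formSign, familySign]

theorem formMatrix_apply (τ : Family) {N : ℕ} (i j : Fin N) :
    formMatrix τ N i j = if j = i.rev then formSign τ i else 0 := by
  cases τ <;> rfl

theorem formMatrix_mul_apply (τ : Family) {N : ℕ} (A : Matrix (Fin N) (Fin N) ℂ) (i j : Fin N) :
    (formMatrix τ N * A) i j = formSign τ i * A i.rev j := by
  simp only [Matrix.mul_apply, formMatrix_apply, ite_mul, zero_mul, sum_ite_eq', mem_univ, if_true]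

theorem transpose_mul_formMatrix_apply (τ : Family) {N : ℕ} (A : Matrix (Fin N) (Fin N) ℂ)
    (i j : Fin N) : (A.transpose * formMatrix τ N) i j = A j.rev i * formSign τ j.rev := by
  simp only [Matrix.mul_apply, Matrix.transpose_apply, formMatrix_apply, ← Fin.rev_eq_iff,
    mul_ite, mul_zero, sum_ite_eq, mem_univ, if_true]

theorem mem_classicalLie_iff (τ : Family) {N : ℕ} (A : Matrix (Fin N) (Fin N) ℂ) :
    A ∈ classicalLie τ N ↔ ∀ i j, A j.rev i.rev = -(formSign τ i * formSign τ j) * A i j := by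
  rw [classicalLie, mem_skewAdjointMatricesLieSubalgebra, mem_skewAdjointMatricesSubmodule,
    Matrix.IsSkewAdjoint, Matrix.IsAdjointPair, Matrix.mul_neg, eq_neg_iff_add_eq_zero,
    ← Matrix.ext_iff]
  simp only [Matrix.add_apply, transpose_mul_formMatrix_apply, formMatrix_mul_apply,
    Matrix.zero_apply]
  constructor
  · intro h i j
    have hij := h j i.rev
    rw [Fin.rev_rev] at hij
    linear_combination formSign τ j * hij - A j.rev i.rev * formSign_mul_self τ j
  · intro h i j
    have hij := h j.rev i
    rw [Fin.rev_rev] at hij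
    rw [hij]
    linear_combination -formSign τ j.rev * A j.rev i * formSign_mul_self τ i

/-- The matrices of the Lie algebra whose non-zero entries are at positions satisfying `P`: the
common form of the parabolic subalgebra, its nilradical and its Levi factor. -/
def supported (τ : Family) (N : ℕ) (P : Fin N → Fin N → Prop) :
    Submodule ℂ (Matrix (Fin N) (Fin N) ℂ) where
  carrier := {A | A ∈ classicalLie τ N ∧ ∀ i j, ¬ P i j → A i j = 0}
  zero_mem' := ⟨zero_mem _, fun _ _ _ => rfl⟩
  add_mem' := fun hA hB => ⟨add_mem hA.1 hB.1, fun i j h => by simp [hA.2 i j h, hB.2 i j h]⟩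
  smul_mem' := fun c A hA => ⟨(classicalLie τ N).smul_mem c hA.1, fun i j h => by
    simp [hA.2 i j h]⟩

section Supported

variable {τ : Family} {N : ℕ} {P : Fin N → Fin N → Prop}

/-- The reflection in the skew diagonal, on the positions satisfying `P`. -/
def reflectPosition (hP : ∀ i j, P i j → P j.rev i.rev) (x : {x : Fin N × Fin N // P x.1 x.2}) :
    {x : Fin N × Fin N // P x.1 x.2} :=
  ⟨(x.1.2.rev, x.1.1.rev), hP _ _ x.2⟩

theorem reflectPosition_eq_self_iff (hP : ∀ i j, P i j → P j.rev i.rev)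
    (x : {x : Fin N × Fin N // P x.1 x.2}) :
    reflectPosition hP x = x ↔ x.1.2 = x.1.1.rev := by
  obtain ⟨⟨i, j⟩, hx⟩ := x
  simp only [reflectPosition, Subtype.mk.injEq, Prod.mk.injEq, Fin.rev_eq_iff]
  exact ⟨fun h => h.1, fun h => ⟨h, by rw [h, Fin.rev_rev]⟩⟩

/-- A matrix of the Lie algebra supported in `P` is the function of its entries at `P`. -/
def supportedEquiv [DecidableRel P] (hP : ∀ i j, P i j → P j.rev i.rev) :
    supported τ N P ≃ₗ[ℂ] equivariantFunctions (reflectPosition hP)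
      (fun x => -(formSign τ x.1.1 * formSign τ x.1.2)) where
  toFun A := ⟨fun x => A.1 x.1.1 x.1.2, fun x => (mem_classicalLie_iff τ A.1).1 A.2.1 _ _⟩
  invFun f := ⟨Matrix.of fun i j => if h : P i j then f.1 ⟨(i, j), h⟩ else 0, by
    refine ⟨(mem_classicalLie_iff τ _).2 fun i j => ?_, fun i j h => dif_neg h⟩
    by_cases h : P i j
    · simp only [Matrix.of_apply, dif_pos h, dif_pos (hP _ _ h)]
      exact f.2 ⟨(i, j), h⟩
    · have h' : ¬ P j.rev i.rev := fun h' => h (by simpa only [Fin.rev_rev] using hP _ _ h')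
      simp only [Matrix.of_apply, dif_neg h, dif_neg h', mul_zero]⟩
  left_inv A := by
    ext i j
    by_cases h : P i j
    · simp [h]
    · simpa [h] using (A.2.2 i j h).symm
  right_inv f := by ext x; simp [x.2]
  map_add' _ _ := rfl
  map_smul' _ _ := rfl

theorem two_mul_finrank_supported [DecidableRel P] (hP : ∀ i j, P i j → P j.rev i.rev)
    (hN : τ = .sp → Even N) :
    2 * (Module.finrank ℂ (supported τ N P) : ℤ) =
      #{x : Fin N × Fin N | P x.1 x.2} + familySign τ * #{i : Fin N | P i i.rev} := by
  have hfixed : ∑ x with reflectPosition hP x = x, -(formSign τ x.1.1 * formSign τ x.1.2) =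
      familySign τ * #{i : Fin N | P i i.rev} := by
    rw [mul_comm, ← nsmul_eq_mul, ← sum_const]
    refine sum_bij (fun x _ => x.1.1) (fun x hx => ?_) (fun x hx y hy hxy => ?_)
      (fun i hi => ⟨⟨(i, i.rev), (mem_filter.1 hi).2⟩, ?_, rfl⟩) fun x hx => ?_
    · rw [mem_filter, reflectPosition_eq_self_iff] at hx
      simpa [← hx.2] using x.2
    · rw [mem_filter, reflectPosition_eq_self_iff] at hx hy
      exact Subtype.ext (Prod.ext hxy (by rw [hx.2, hy.2, hxy]))
    · simp [reflectPosition_eq_self_iff]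
    · rw [mem_filter, reflectPosition_eq_self_iff] at hx
      rw [hx.2, formSign_rev hN]
      linear_combination (familySign τ : ℂ) * formSign_mul_self τ x.1.1
  have hfinrank := two_mul_finrank_equivariantFunctions
    (σ := fun x => -(formSign τ x.1.1 * formSign τ x.1.2))
    (fun x : {x : Fin N × Fin N // P x.1 x.2} => by
      simp only [reflectPosition, Fin.rev_rev] : (reflectPosition hP).Involutive) fun x => by
    have hε : (familySign τ * familySign τ : ℂ) = 1 := by exact_mod_cast familySign_mul_self τ
    simp only [reflectPosition, formSign_rev hN]
    linear_combination (formSign τ x.1.1 * formSign τ x.1.1) * formSign_mul_self τ x.1.2 +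
      formSign_mul_self τ x.1.1 +
      (formSign τ x.1.1 * formSign τ x.1.1 * (formSign τ x.1.2 * formSign τ x.1.2)) * hε
  rw [hfixed, Fintype.card_subtype, ← (supportedEquiv hP).finrank_eq] at hfinrank
  exact_mod_cast hfinrank

end Supported

/-! ## Reduction to a bound for the centralizer -/

theorem blockIndex_lt {d : List ℕ} {a : ℕ} (ha : a < d.sum) : blockIndex d a < d.length := by
  induction d generalizing a with
  | nil => simp at ha
  | cons x d ih =>
    rw [List.sum_cons] at ha
    simp only [blockIndex, List.length_cons]
    split_ifs
    · omega
    · have := ih (a := a - x) (by omega)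
      omega

theorem blockIndex_append (d e : List ℕ) (a : ℕ) : blockIndex (d ++ e) a =
    if a < d.sum then blockIndex d a else blockIndex e (a - d.sum) + d.length := by
  induction d generalizing a with
  | nil => simp
  | cons x d ih =>
    simp only [List.cons_append, blockIndex, List.sum_cons, List.length_cons, ih]
    split_ifs <;> first | omega | rw [Nat.sub_sub, Nat.add_assoc]

theorem blockIndex_reverse {d : List ℕ} {a : ℕ} (ha : a < d.sum) :
    blockIndex d.reverse (d.sum - 1 - a) + blockIndex d a + 1 = d.length := by
  induction d generalizing a with
  | nil => simp at ha
  | cons x d ih =>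
    rw [List.sum_cons] at ha
    rw [List.reverse_cons, blockIndex_append, List.sum_reverse, List.sum_cons, List.length_reverse]
    simp only [blockIndex, List.length_cons]
    by_cases h : a < x
    · rw [if_neg (by omega), if_pos (by omega), if_pos h]
      omega
    · have := ih (a := a - x) (by omega)
      rw [if_pos (by omega), if_neg h, show x + d.sum - 1 - a = d.sum - 1 - (a - x) by omega]
      omega

theorem block_rev {d : List ℕ} (hd : d.reverse = d) (a : Fin d.sum) :
    block d a.rev + block d a + 1 = d.length := by
  have := blockIndex_reverse a.isLt
  rwa [hd, show d.sum - 1 - a.val = d.sum - (a.val + 1) by omega, ← Fin.val_rev] at this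

section Reduction

variable {τ : Family} {d : List ℕ} {A X : Matrix (Fin d.sum) (Fin d.sum) ℂ}

theorem mem_parabolic_iff :
    A ∈ parabolic τ d ↔ A ∈ classicalLie τ d.sum ∧ ∀ a b, block d b < block d a → A a b = 0 :=
  Iff.rfl

theorem mem_nilradical_iff :
    A ∈ nilradical τ d ↔ A ∈ classicalLie τ d.sum ∧ ∀ a b, block d b ≤ block d a → A a b = 0 :=
  Iff.rfl

theorem lie_mem_nilradical (hA : A ∈ parabolic τ d) (hX : X ∈ nilradical τ d) :
    ⁅A, X⁆ ∈ nilradical τ d := by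
  refine ⟨(classicalLie τ d.sum).lie_mem hA.1 hX.1, fun a b hab => ?_⟩
  have hAX : ∀ x, A a x * X x b = 0 := fun x => by
    by_cases h : block d b ≤ block d x
    · rw [hX.2 x b h, mul_zero]
    · rw [(mem_parabolic_iff.1 hA).2 a x (by omega), zero_mul]
  have hXA : ∀ x, X a x * A x b = 0 := fun x => by
    by_cases h : block d x ≤ block d a
    · rw [hX.2 a x h, zero_mul]
    · rw [(mem_parabolic_iff.1 hA).2 x b (by omega), mul_zero]
  rw [Ring.lie_def, Matrix.sub_apply, Matrix.mul_apply, Matrix.mul_apply,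
    sum_eq_zero fun x _ => hAX x, sum_eq_zero fun x _ => hXA x, sub_zero]

theorem parabolic_eq_supported (τ : Family) (d : List ℕ) :
    (parabolic τ d).toSubmodule = supported τ d.sum fun i j => block d i ≤ block d j := by
  ext A
  simp only [supported, LieSubalgebra.mem_toSubmodule, mem_parabolic_iff, not_le]
  rfl

theorem nilradical_eq_supported (τ : Family) (d : List ℕ) :
    nilradical τ d = supported τ d.sum fun i j => block d i < block d j := by
  ext A
  simp only [supported, mem_nilradical_iff, not_lt]
  rfl

theorem leviFactor_eq_supported (τ : Family) (d : List ℕ) :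
    leviFactor τ d = supported τ d.sum fun i j => block d i = block d j := rfl

theorem card_filter_le_eq_add {Y α : Type*} [LinearOrder α] (s : Finset Y) (f g : Y → α) :
    #{x ∈ s | f x ≤ g x} = #{x ∈ s | f x = g x} + #{x ∈ s | f x < g x} := by
  classical
  rw [← card_union_of_disjoint (disjoint_filter.2 fun x _ h => h.not_lt), ← filter_or]
  simp only [le_iff_eq_or_lt]

theorem finrank_parabolic (hN : τ = .sp → Even d.sum) (hd : d.reverse = d) :
    Module.finrank ℂ (parabolic τ d).toSubmodule =
      Module.finrank ℂ (leviFactor τ d) + Module.finrank ℂ (nilradical τ d) := by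
  have hrev := block_rev hd
  have hp := two_mul_finrank_supported (P := fun i j => block d i ≤ block d j)
    (fun i j _ => by have := hrev i; have := hrev j; omega) hN
  have hm := two_mul_finrank_supported (P := fun i j => block d i = block d j)
    (fun i j _ => by have := hrev i; have := hrev j; omega) hN
  have hn := two_mul_finrank_supported (P := fun i j => block d i < block d j)
    (fun i j _ => by have := hrev i; have := hrev j; omega) hN
  rw [card_filter_le_eq_add, card_filter_le_eq_add, ← parabolic_eq_supported] at hp
  rw [← leviFactor_eq_supported] at hm
  rw [← nilradical_eq_supported] at hn
  push_cast at hp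
  linarith

/-- The map `A ↦ [A, X]` from the parabolic subalgebra to its nilradical. -/
def parabolicToNilradical (hX : X ∈ nilradical τ d) :
    (parabolic τ d).toSubmodule →ₗ[ℂ] nilradical τ d where
  toFun A := ⟨⁅A.1, X⁆, lie_mem_nilradical A.2 hX⟩
  map_add' _ _ := Subtype.ext (add_lie _ _ _)
  map_smul' _ _ := Subtype.ext (smul_lie _ _ _)

theorem finrank_ker_parabolicToNilradical_le (hX : X ∈ nilradical τ d) :
    Module.finrank ℂ (LinearMap.ker (parabolicToNilradical hX)) ≤
      Module.finrank ℂ (centralizer τ X) := by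
  let inclusion : LinearMap.ker (parabolicToNilradical hX) →ₗ[ℂ] centralizer τ X :=
    { toFun := fun A => ⟨A.1.1, A.1.2.1, congrArg Subtype.val (LinearMap.mem_ker.1 A.2)⟩
      map_add' := fun _ _ => rfl
      map_smul' := fun _ _ => rfl }
  refine LinearMap.finrank_le_finrank_of_injective (f := inclusion) fun A B hAB => ?_
  exact Subtype.ext (Subtype.ext (congrArg (fun C : centralizer τ X => C.1) hAB))

-- Rank-nullity: `dim 𝔭 = dim 𝔪 + dim 𝔫`, so a kernel of dimension at most `dim 𝔪` leaves no room
-- for a proper image.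
theorem isRichardson_of_finrank_centralizer_le (hN : τ = .sp → Even d.sum) (hd : d.reverse = d)
    (hX : X ∈ nilradical τ d)
    (h : Module.finrank ℂ (centralizer τ X) ≤ Module.finrank ℂ (leviFactor τ d)) :
    IsRichardson τ d X ∧
      Module.finrank ℂ (centralizer τ X) = Module.finrank ℂ (leviFactor τ d) := by
  have hrank := (parabolicToNilradical hX).finrank_range_add_finrank_ker
  rw [finrank_parabolic hN hd] at hrank
  have hker := finrank_ker_parabolicToNilradical_le hX
  have hrange := Submodule.finrank_le (LinearMap.range (parabolicToNilradical hX))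
  have htop : LinearMap.range (parabolicToNilradical hX) = ⊤ :=
    Submodule.eq_top_of_finrank_eq (by omega)
  refine ⟨⟨hX, Set.ext fun Y => ⟨?_, fun hY => ?_⟩⟩, by omega⟩
  · rintro ⟨A, hA, rfl⟩
    exact lie_mem_nilradical hA hX
  · obtain ⟨A, hA⟩ := LinearMap.range_eq_top.1 htop ⟨Y, hY⟩
    exact ⟨A.1, A.2, congrArg Subtype.val hA⟩

end Reduction

/-! ## Systems of chains -/

/-- A partition of the vertices `0, …, N - 1` into chains that is stable under the mirror image
`v ↦ v.rev`: the chain with label `bar k` is the mirror image of the chain with label `k`. Empty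
chains are allowed. -/
structure ChainSystem (N : ℕ) (K : Type*) where
  chain : K → List (Fin N)
  bar : K → K
  nodup_chain : ∀ k, (chain k).Nodup
  exists_mem_chain : ∀ v, ∃ k, v ∈ chain k
  eq_of_mem_chain : ∀ {k k' v}, v ∈ chain k → v ∈ chain k' → k = k'
  bar_bar : ∀ k, bar (bar k) = k
  chain_bar : ∀ k, chain (bar k) = ((chain k).map Fin.rev).reverse

namespace ChainSystem

variable {N : ℕ} {K : Type*} (S : ChainSystem N K)

theorem length_chain_bar (k : K) : (S.chain (S.bar k)).length = (S.chain k).length := by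
  rw [S.chain_bar, List.length_reverse, List.length_map]

theorem getElem_chain_bar {k : K} {a : ℕ} (ha : a < (S.chain (S.bar k)).length) :
    (S.chain (S.bar k))[a] =
      ((S.chain k)[(S.chain k).length - 1 - a]'(by have := S.length_chain_bar k; omega)).rev := by
  simp only [S.chain_bar, List.getElem_reverse, List.getElem_map, List.length_map]

theorem rev_getElem_chain {k : K} {a : ℕ} (ha : a < (S.chain k).length) :
    ((S.chain k)[a]).rev = (S.chain (S.bar k))[(S.chain k).length - 1 - a]'(by
      have := S.length_chain_bar k; omega) := by
  rw [S.getElem_chain_bar, Fin.rev_inj]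
  congr 1
  omega

theorem exists_getElem_chain_eq (v : Fin N) :
    ∃ (k : K) (a : ℕ) (ha : a < (S.chain k).length), (S.chain k)[a] = v := by
  obtain ⟨k, hk⟩ := S.exists_mem_chain v
  exact ⟨k, List.mem_iff_getElem.1 hk⟩

/-- The label of the chain through a vertex. -/
noncomputable def label (v : Fin N) : K := (S.exists_mem_chain v).choose

variable {S}

theorem label_eq_iff {v : Fin N} {k : K} : S.label v = k ↔ v ∈ S.chain k :=
  ⟨fun h => h ▸ (S.exists_mem_chain v).choose_spec,
    S.eq_of_mem_chain (S.exists_mem_chain v).choose_spec⟩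

theorem eq_and_eq_of_getElem_chain_eq {k k' : K} {a b : ℕ} {ha : a < (S.chain k).length}
    {hb : b < (S.chain k').length} (h : (S.chain k)[a] = (S.chain k')[b]) : k = k' ∧ a = b := by
  obtain rfl := S.eq_of_mem_chain (List.getElem_mem ha) (h ▸ List.getElem_mem hb)
  exact ⟨rfl, (S.nodup_chain k).getElem_inj_iff.1 h⟩

variable (S)

/-- The line `i — j`: `j` is the successor of `i` in some chain. -/
def Line (i j : Fin N) : Prop :=
  ∃ (k : K) (a : ℕ) (h : a + 1 < (S.chain k).length), (S.chain k)[a] = i ∧ (S.chain k)[a + 1] = j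

variable {S}

theorem line_getElem {k : K} {a : ℕ} (h : a + 1 < (S.chain k).length) :
    S.Line (S.chain k)[a] (S.chain k)[a + 1] :=
  ⟨k, a, h, rfl, rfl⟩

theorem line_getElem_left_iff {k : K} {a : ℕ} {ha : a < (S.chain k).length} {j : Fin N} :
    S.Line (S.chain k)[a] j ↔ ∃ h : a + 1 < (S.chain k).length, (S.chain k)[a + 1] = j := by
  refine ⟨?_, fun ⟨h, hj⟩ => hj ▸ line_getElem h⟩
  rintro ⟨k', a', h, hi, hj⟩
  obtain ⟨rfl, rfl⟩ := eq_and_eq_of_getElem_chain_eq hi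
  exact ⟨h, hj⟩

theorem line_getElem_succ_iff {k : K} {b : ℕ} {hb : b + 1 < (S.chain k).length} {i : Fin N} :
    S.Line i (S.chain k)[b + 1] ↔ (S.chain k)[b] = i := by
  refine ⟨?_, fun hi => hi ▸ line_getElem hb⟩
  rintro ⟨k', b', h, hi, hj⟩
  obtain ⟨rfl, hb'⟩ := eq_and_eq_of_getElem_chain_eq hj
  obtain rfl : b' = b := by omega
  exact hi

theorem not_line_getElem_zero {k : K} (hk : 0 < (S.chain k).length) (i : Fin N) :
    ¬ S.Line i (S.chain k)[0] := by
  rintro ⟨k', b', h, -, hj⟩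
  exact absurd (eq_and_eq_of_getElem_chain_eq hj).2 (by omega)

theorem Line.rev {i j : Fin N} (h : S.Line i j) : S.Line j.rev i.rev := by
  obtain ⟨k, a, h, rfl, rfl⟩ := h
  have hlen := S.length_chain_bar k
  rw [S.rev_getElem_chain h, S.rev_getElem_chain (Nat.lt_of_succ_lt h), line_getElem_left_iff]
  exact ⟨by omega, by congr 1; omega⟩

theorem line_rev_iff {i j : Fin N} : S.Line j.rev i.rev ↔ S.Line i j :=
  ⟨fun h => by simpa only [Fin.rev_rev] using h.rev, Line.rev⟩

variable (S)

/-- `X` is a linear combination with coefficients `±1` of the matrix units `E_{ij}` for the lines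
`i — j`. -/
structure IsLineMatrix (X : Matrix (Fin N) (Fin N) ℂ) : Prop where
  apply_eq_zero : ∀ {i j}, ¬ S.Line i j → X i j = 0
  apply_mul_self : ∀ {i j}, S.Line i j → X i j * X i j = 1

/-- The signs `g` turn the line matrix `X` into the `0`-`1`-matrix of the lines: conjugation by the
diagonal matrix of `g` removes the signs of `X`. -/
structure IsGauge (X : Matrix (Fin N) (Fin N) ℂ) (g : Fin N → ℂ) : Prop where
  mul_self : ∀ v, g v * g v = 1
  apply_eq_zero : ∀ {i j}, ¬ S.Line i j → X i j = 0
  apply_eq_mul : ∀ {i j}, S.Line i j → X i j = g i * g j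

variable {S} {X : Matrix (Fin N) (Fin N) ℂ}

-- Take the product of the signs of the lines that precede a vertex in its chain.
theorem IsLineMatrix.exists_isGauge (hX : S.IsLineMatrix X) : ∃ g, S.IsGauge X g := by
  let entry (k : K) (a : ℕ) : ℂ :=
    if h : a + 1 < (S.chain k).length then X (S.chain k)[a] (S.chain k)[a + 1] else 1
  have hentry (k : K) (a : ℕ) : entry k a * entry k a = 1 := by
    by_cases h : a + 1 < (S.chain k).length
    · simp only [entry, dif_pos h, hX.apply_mul_self (line_getElem h)]
    · simp only [entry, dif_neg h, mul_one]
  let g (v : Fin N) : ℂ := ∏ a ∈ range ((S.chain (S.label v)).idxOf v), entry (S.label v) a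
  have hg {k : K} {a : ℕ} (ha : a < (S.chain k).length) :
      g (S.chain k)[a] = ∏ b ∈ range a, entry k b := by
    simp only [g]
    rw [label_eq_iff.2 (List.getElem_mem ha), (S.nodup_chain k).idxOf_getElem]
  have hg_self (v : Fin N) : g v * g v = 1 := by
    simp only [g, ← prod_mul_distrib, hentry, prod_const_one]
  refine ⟨g, hg_self, hX.apply_eq_zero, ?_⟩
  rintro i j ⟨k, a, h, rfl, rfl⟩
  have hX_entry : X (S.chain k)[a] (S.chain k)[a + 1] = entry k a := by simp only [entry, dif_pos h]
  have hsq := hg_self (S.chain k)[a]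
  rw [hg (Nat.lt_of_succ_lt h)] at hsq
  rw [hX_entry, hg h, hg (Nat.lt_of_succ_lt h), prod_range_succ, ← mul_assoc, hsq, one_mul]

/-! ## Centralizers of line matrices -/

/-- The conjugate of `A` by the diagonal matrix of the signs `g`. -/
def gauged (g : Fin N → ℂ) (A : Matrix (Fin N) (Fin N) ℂ) (i j : Fin N) : ℂ := g i * A i j * g j

namespace IsGauge

variable {g : Fin N → ℂ} (hg : S.IsGauge X g)

include hg

theorem mul_apply_succ (A : Matrix (Fin N) (Fin N) ℂ) (i : Fin N) {k : K} {b : ℕ}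
    (hb : b + 1 < (S.chain k).length) :
    (A * X) i (S.chain k)[b + 1] =
      A i (S.chain k)[b] * (g (S.chain k)[b] * g (S.chain k)[b + 1]) := by
  rw [Matrix.mul_apply, sum_eq_single (S.chain k)[b], hg.apply_eq_mul (line_getElem hb)]
  · intro x _ hx
    rw [hg.apply_eq_zero fun h => hx (line_getElem_succ_iff.1 h).symm, mul_zero]
  · simp

theorem mul_apply_zero (A : Matrix (Fin N) (Fin N) ℂ) (i : Fin N) {k : K}
    (hk : 0 < (S.chain k).length) : (A * X) i (S.chain k)[0] = 0 := by
  rw [Matrix.mul_apply]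
  exact sum_eq_zero fun x _ => by rw [hg.apply_eq_zero (not_line_getElem_zero hk x), mul_zero]

theorem apply_mul_getElem (A : Matrix (Fin N) (Fin N) ℂ) (j : Fin N) {k : K} {a : ℕ}
    (ha : a + 1 < (S.chain k).length) :
    (X * A) (S.chain k)[a] j =
      g (S.chain k)[a] * g (S.chain k)[a + 1] * A (S.chain k)[a + 1] j := by
  rw [Matrix.mul_apply, sum_eq_single (S.chain k)[a + 1], hg.apply_eq_mul (line_getElem ha)]
  · intro x _ hx
    rw [hg.apply_eq_zero fun h => hx (line_getElem_left_iff.1 h).2.symm, zero_mul]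
  · simp

theorem apply_mul_last (A : Matrix (Fin N) (Fin N) ℂ) (j : Fin N) {k : K} {a : ℕ}
    (ha : a + 1 = (S.chain k).length) : (X * A) (S.chain k)[a] j = 0 := by
  rw [Matrix.mul_apply]
  refine sum_eq_zero fun x _ => ?_
  rw [hg.apply_eq_zero fun h => absurd (line_getElem_left_iff.1 h).1 (by omega), zero_mul]

variable {A : Matrix (Fin N) (Fin N) ℂ} (hA : A * X = X * A)

include hA

theorem gauged_add {k k' : K} {a b : ℕ} (m : ℕ) (ha : a + m < (S.chain k).length)
    (hb : b + m < (S.chain k').length) :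
    gauged g A (S.chain k)[a] (S.chain k')[b] =
      gauged g A (S.chain k)[a + m] (S.chain k')[b + m] := by
  induction m with
  | zero => rfl
  | succ m ih =>
    rw [ih (by omega) (by omega)]
    rw [← Nat.add_assoc] at ha hb
    have hentry := congrFun₂ hA (S.chain k)[a + m] (S.chain k')[b + m + 1]
    rw [hg.mul_apply_succ A _ hb, hg.apply_mul_getElem A _ ha] at hentry
    simp only [gauged, ← Nat.add_assoc]
    linear_combination (g (S.chain k)[a + m] * g (S.chain k')[b + m + 1]) * hentry
      - g (S.chain k)[a + m] * A (S.chain k)[a + m] (S.chain k')[b + m] * g (S.chain k')[b + m] *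
        hg.mul_self (S.chain k')[b + m + 1]
      + g (S.chain k)[a + m + 1] * A (S.chain k)[a + m + 1] (S.chain k')[b + m + 1] *
        g (S.chain k')[b + m + 1] * hg.mul_self (S.chain k)[a + m]

theorem gauged_eq_zero_of_lt {k k' : K} {a b : ℕ} (ha : a < (S.chain k).length)
    (hb : b < (S.chain k').length) (hba : b < a) :
    gauged g A (S.chain k)[a] (S.chain k')[b] = 0 := by
  obtain ⟨m, rfl⟩ := Nat.exists_eq_add_of_lt hba
  have hentry := congrFun₂ hA (S.chain k)[m] ((S.chain k')[0]'(by omega))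
  rw [hg.mul_apply_zero A _ (by omega), hg.apply_mul_getElem A _ (by omega)] at hentry
  have hzero : gauged g A ((S.chain k)[m + 1]'(by omega)) ((S.chain k')[0]'(by omega)) = 0 := by
    simp only [gauged]
    linear_combination -(g (S.chain k)[m] * g (S.chain k')[0]) * hentry
      - g (S.chain k)[m + 1] * A (S.chain k)[m + 1] (S.chain k')[0] * g (S.chain k')[0] *
        hg.mul_self (S.chain k)[m]
  rw [hg.gauged_add hA b (by omega) (by omega)] at hzero
  simpa only [Nat.zero_add, show m + 1 + b = b + m + 1 by omega] using hzero

theorem gauged_eq_zero_of_length_lt {k k' : K} {a b : ℕ} (ha : a < (S.chain k).length)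
    (hb : b < (S.chain k').length) (hlt : b + (S.chain k).length < a + (S.chain k').length) :
    gauged g A (S.chain k)[a] (S.chain k')[b] = 0 := by
  obtain ⟨m, hm⟩ : ∃ m, a + m + 1 = (S.chain k).length := ⟨(S.chain k).length - 1 - a, by omega⟩
  have hentry := congrFun₂ hA ((S.chain k)[a + m]'(by omega)) ((S.chain k')[b + m + 1]'(by omega))
  rw [hg.mul_apply_succ A _ (by omega), hg.apply_mul_last A _ hm] at hentry
  rw [hg.gauged_add hA m (by omega) (by omega)]
  simp only [gauged]
  linear_combination (g (S.chain k)[a + m] * g (S.chain k')[b + m + 1]) * hentry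
    - g (S.chain k)[a + m] * A (S.chain k)[a + m] (S.chain k')[b + m] * g (S.chain k')[b + m] *
      hg.mul_self (S.chain k')[b + m + 1]

end IsGauge

end ChainSystem

namespace ChainSystem

variable {N : ℕ} {K : Type*} {S : ChainSystem N K}
  {X : Matrix (Fin N) (Fin N) ℂ}

/-- The sign through which the mirror image acts on gauged matrices of the Lie algebra. -/
def gaugeSign (τ : Family) (g : Fin N → ℂ) (v : Fin N) : ℂ := formSign τ v * g v * g v.rev

theorem gaugeSign_rev {τ : Family} (hN : τ = .sp → Even N) (g : Fin N → ℂ) (v : Fin N) :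
    gaugeSign τ g v.rev = -familySign τ * gaugeSign τ g v := by
  simp only [gaugeSign, formSign_rev hN, Fin.rev_rev]
  ring

namespace IsGauge

variable {τ : Family} {g : Fin N → ℂ} (hg : S.IsGauge X g)

include hg

theorem gaugeSign_mul_self (v : Fin N) : gaugeSign τ g v * gaugeSign τ g v = 1 := by
  simp only [gaugeSign]
  linear_combination g v * g v * g v.rev * g v.rev * formSign_mul_self τ v +
    g v.rev * g v.rev * hg.mul_self v + hg.mul_self v.rev

theorem gauged_rev {A : Matrix (Fin N) (Fin N) ℂ} (hA : A ∈ classicalLie τ N) (i j : Fin N) :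
    gauged g A j.rev i.rev = -(gaugeSign τ g i * gaugeSign τ g j) * gauged g A i j := by
  simp only [gauged, gaugeSign, (mem_classicalLie_iff τ A).1 hA i j]
  linear_combination
    g i.rev * g j.rev * formSign τ i * formSign τ j * A i j * (g i * g i) * hg.mul_self j +
    g i.rev * g j.rev * formSign τ i * formSign τ j * A i j * hg.mul_self i

theorem gaugeSign_of_line (hX : X ∈ classicalLie τ N) {i j : Fin N} (h : S.Line i j) :
    gaugeSign τ g j = -gaugeSign τ g i := by
  have hskew := (mem_classicalLie_iff τ X).1 hX i j
  rw [hg.apply_eq_mul h, hg.apply_eq_mul h.rev] at hskew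
  have hmul : gaugeSign τ g i * gaugeSign τ g j = -1 := by
    simp only [gaugeSign]
    linear_combination (formSign τ i * formSign τ j * g i * g j) * hskew
      - (formSign τ i * formSign τ i * (formSign τ j * formSign τ j)) *
        (g j * g j * hg.mul_self i + hg.mul_self j)
      - formSign τ j * formSign τ j * formSign_mul_self τ i - formSign_mul_self τ j
  linear_combination gaugeSign τ g i * hmul - gaugeSign τ g j * hg.gaugeSign_mul_self (τ := τ) i

theorem gaugeSign_getElem_add (hX : X ∈ classicalLie τ N) {k : K} {a : ℕ} (m : ℕ)
    (h : a + m < (S.chain k).length) :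
    gaugeSign τ g (S.chain k)[a + m] = (-1) ^ m * gaugeSign τ g (S.chain k)[a] := by
  induction m with
  | zero => simp
  | succ m ih =>
    have hline := hg.gaugeSign_of_line hX (S.line_getElem (a := a + m) h)
    simp only [← Nat.add_assoc]
    rw [hline, ih (by omega)]
    ring

end IsGauge

/-! ## The coordinates of a centralizer -/

variable (S)

/-- A gauged matrix in the centralizer is constant along the diagonals of the blocks given by the
pairs of chains `(k, k')`, and it vanishes on all but the last `min` of them. These diagonals are
the coordinates: the `m`-th one starts at the entry in the first row and the `m`-th last column. -/
abbrev Diagonal : Type _ := Σ p : K × K, Fin (min (S.chain p.1).length (S.chain p.2).length)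

variable {S}

theorem Diagonal.ext {x y : S.Diagonal} (h : x.1 = y.1) (hval : x.2.val = y.2.val) : x = y := by
  obtain ⟨p, m⟩ := x
  obtain ⟨q, n⟩ := y
  obtain rfl : p = q := h
  obtain rfl : m = n := Fin.ext hval
  rfl

/-- The first row of a diagonal. -/
def Diagonal.source (x : S.Diagonal) : Fin N := (S.chain x.1.1)[0]'(by have := x.2.isLt; omega)

/-- The column of a diagonal in its first row. -/
def Diagonal.target (x : S.Diagonal) : Fin N :=
  (S.chain x.1.2)[(S.chain x.1.2).length - 1 - x.2.val]'(by have := x.2.isLt; omega)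

/-- The mirror image of a diagonal. -/
def Diagonal.reflect (x : S.Diagonal) : S.Diagonal :=
  ⟨(S.bar x.1.2, S.bar x.1.1), x.2.val, by
    have := x.2.isLt
    have := S.length_chain_bar x.1.1
    have := S.length_chain_bar x.1.2
    simp only
    omega⟩

theorem Diagonal.reflect_involutive : (Diagonal.reflect (S := S)).Involutive := fun x =>
  Diagonal.ext (by simp only [reflect, S.bar_bar]) rfl

theorem Diagonal.source_reflect (x : S.Diagonal) : x.reflect.source =
    ((S.chain x.1.2)[(S.chain x.1.2).length - 1]'(by have := x.2.isLt; omega)).rev := by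
  simp only [source, reflect, S.getElem_chain_bar, Nat.sub_zero]

theorem Diagonal.target_reflect (x : S.Diagonal) : x.reflect.target =
    ((S.chain x.1.1)[x.2.val]'(by have := x.2.isLt; omega)).rev := by
  have := x.2.isLt
  have := S.length_chain_bar x.1.1
  simp only [target, reflect, S.getElem_chain_bar, Fin.rev_inj]
  congr 1
  omega

/-- The weight of a diagonal under the mirror image. -/
def Diagonal.weight (τ : Family) (g : Fin N → ℂ) (x : S.Diagonal) : ℂ :=
  -(gaugeSign τ g x.source * gaugeSign τ g x.target)

namespace IsGauge

variable {τ : Family} {g : Fin N → ℂ} (hg : S.IsGauge X g)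

include hg

theorem weight_eq (hX : X ∈ classicalLie τ N) (x : S.Diagonal) :
    x.weight τ g =
      -(gaugeSign τ g ((S.chain x.1.1)[x.2.val]'(by have := x.2.isLt; omega)) *
        gaugeSign τ g ((S.chain x.1.2)[(S.chain x.1.2).length - 1]'(by
          have := x.2.isLt; omega))) := by
  have hlt := x.2.isLt
  have hsource := hg.gaugeSign_getElem_add hX (k := x.1.1) (a := 0) x.2.val (by omega)
  have htarget := hg.gaugeSign_getElem_add hX (k := x.1.2)
    (a := (S.chain x.1.2).length - 1 - x.2.val) x.2.val (by omega)
  have hsq : ((-1) ^ x.2.val * (-1) ^ x.2.val : ℂ) = 1 := by rw [← mul_pow]; simp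
  simp only [Nat.zero_add] at hsource
  simp only [show (S.chain x.1.2).length - 1 - x.2.val + x.2.val = (S.chain x.1.2).length - 1 by
    omega] at htarget
  rw [hsource, htarget, Diagonal.weight]
  simp only [Diagonal.source, Diagonal.target]
  linear_combination gaugeSign τ g ((S.chain x.1.1)[0]'(by omega)) * gaugeSign τ g
    ((S.chain x.1.2)[(S.chain x.1.2).length - 1 - x.2.val]'(by omega)) * hsq

theorem weight_reflect_mul_weight (hN : τ = .sp → Even N) (hX : X ∈ classicalLie τ N)
    (x : S.Diagonal) : x.reflect.weight τ g * x.weight τ g = 1 := by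
  have hε : (familySign τ * familySign τ : ℂ) = 1 := by exact_mod_cast familySign_mul_self τ
  have := x.2.isLt
  have hrow := hg.gaugeSign_mul_self (τ := τ) ((S.chain x.1.1)[x.2.val]'(by omega))
  have hcol := hg.gaugeSign_mul_self (τ := τ)
    ((S.chain x.1.2)[(S.chain x.1.2).length - 1]'(by omega))
  rw [hg.weight_eq hX x, Diagonal.weight, x.source_reflect, x.target_reflect, gaugeSign_rev hN,
    gaugeSign_rev hN]
  generalize gaugeSign τ g _ = s at *
  generalize gaugeSign τ g _ = t at *
  linear_combination (s * s * (t * t)) * hε + s * s * hcol + hrow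

theorem weight_of_reflect_eq_self (hN : τ = .sp → Even N) (hX : X ∈ classicalLie τ N)
    {x : S.Diagonal} (hx : x.reflect = x) : x.weight τ g = familySign τ * (-1) ^ x.2.val := by
  have := x.2.isLt
  have hsign := hg.gaugeSign_getElem_add hX (k := x.1.1) (a := 0) x.2.val (by omega)
  simp only [Nat.zero_add] at hsign
  have hsource := hg.gaugeSign_mul_self (τ := τ) x.source
  rw [Diagonal.weight, show x.target = _ from hx ▸ x.target_reflect, gaugeSign_rev hN, hsign]
  rw [Diagonal.source] at hsource ⊢
  linear_combination familySign τ * (-1) ^ x.2.val * hsource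

theorem gauged_reflect {A : Matrix (Fin N) (Fin N) ℂ} (hX : X ∈ classicalLie τ N)
    (hA : A ∈ classicalLie τ N) (hAX : A * X = X * A) (x : S.Diagonal) :
    gauged g A x.reflect.source x.reflect.target =
      x.weight τ g * gauged g A x.source x.target := by
  have := x.2.isLt
  have hdiag := hg.gauged_add hAX (k := x.1.1) (k' := x.1.2) (a := 0)
    (b := (S.chain x.1.2).length - 1 - x.2.val) x.2.val (by omega) (by omega)
  simp only [Nat.zero_add, show (S.chain x.1.2).length - 1 - x.2.val + x.2.val =
    (S.chain x.1.2).length - 1 by omega] at hdiag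
  rw [x.source_reflect, x.target_reflect, hg.gauged_rev hA, hg.weight_eq hX, ← hdiag,
    Diagonal.source, Diagonal.target]

theorem eq_zero_of_gauged_diagonal_eq_zero {A : Matrix (Fin N) (Fin N) ℂ} (hAX : A * X = X * A)
    (h : ∀ x : S.Diagonal, gauged g A x.source x.target = 0) : A = 0 := by
  suffices hgauged : ∀ i j, gauged g A i j = 0 by
    ext i j
    have hij := hgauged i j
    simp only [gauged] at hij
    rw [Matrix.zero_apply]
    linear_combination g i * g j * hij - A i j * g j * g j * hg.mul_self i - A i j * hg.mul_self j
  intro i j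
  obtain ⟨k, a, ha, rfl⟩ := S.exists_getElem_chain_eq i
  obtain ⟨k', b, hb, rfl⟩ := S.exists_getElem_chain_eq j
  rcases lt_or_ge b a with hba | hab
  · exact hg.gauged_eq_zero_of_lt hAX ha hb hba
  rcases lt_or_ge (b + (S.chain k).length) (a + (S.chain k').length) with hlt | hge
  · exact hg.gauged_eq_zero_of_length_lt hAX ha hb hlt
  obtain ⟨c, rfl⟩ := Nat.exists_eq_add_of_le hab
  have hdiag := h ⟨(k, k'), (S.chain k').length - 1 - c, by simp only; omega⟩
  simp only [Diagonal.source, Diagonal.target] at hdiag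
  rw [hg.gauged_add hAX a (by omega) (by omega)] at hdiag
  simpa only [Nat.zero_add, show (S.chain k').length - 1 - ((S.chain k').length - 1 - c) + a =
    a + c by omega] using hdiag

/-- The coordinates of the elements of a centralizer. -/
def coordinates (hX : X ∈ classicalLie τ N) : centralizer τ X →ₗ[ℂ]
    equivariantFunctions (Diagonal.reflect (S := S)) (Diagonal.weight τ g) where
  toFun A := ⟨fun x => gauged g A.1 x.source x.target, hg.gauged_reflect hX A.2.1
    (sub_eq_zero.1 A.2.2)⟩
  map_add' A B := by ext x; simp [gauged]; ring
  map_smul' c A := by ext x; simp [gauged]; ring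

theorem coordinates_injective (hX : X ∈ classicalLie τ N) :
    Function.Injective (hg.coordinates hX) := by
  refine (injective_iff_map_eq_zero _).2 fun A hA => Subtype.ext ?_
  exact hg.eq_zero_of_gauged_diagonal_eq_zero (sub_eq_zero.1 A.2.2) fun x =>
    congrFun (congrArg Subtype.val hA) x

end IsGauge

theorem sum_range_neg_one_pow (n : ℕ) : ∑ m ∈ range n, (-1 : ℤ) ^ m = (n % 2 : ℕ) := by
  induction n with
  | zero => rfl
  | succ n ih =>
    rw [sum_range_succ, ih]
    rcases Nat.even_or_odd n with h | h
    · rw [h.neg_one_pow]; obtain ⟨t, rfl⟩ := h; omega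
    · rw [h.neg_one_pow]; obtain ⟨t, rfl⟩ := h; omega

theorem sum_neg_one_pow_of_reflect_eq_self [Fintype K] [DecidableEq K] :
    ∑ x : S.Diagonal with x.reflect = x, (-1 : ℤ) ^ x.2.val =
      ∑ k, ((S.chain k).length % 2 : ℕ) := by
  have hfixed (x : S.Diagonal) : x.reflect = x ↔ x.1.2 = S.bar x.1.1 := by
    refine ⟨fun h => ?_, fun h => Diagonal.ext (Prod.ext ?_ h.symm) rfl⟩
    · exact (congrArg (fun y : S.Diagonal => y.1.2) h).symm
    · simp only [Diagonal.reflect]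
      rw [h, S.bar_bar]
  simp only [sum_filter, hfixed, Fintype.sum_sigma, Fintype.sum_prod_type]
  push_cast
  refine sum_congr rfl fun k _ => ?_
  rw [sum_eq_single (S.bar k) (fun k' _ hk' => by simp [hk']) (by simp)]
  simp only [if_true]
  rw [Fin.sum_univ_eq_sum_range (fun m => (-1 : ℤ) ^ m), sum_range_neg_one_pow, S.length_chain_bar,
    min_self]
  norm_cast

theorem IsLineMatrix.two_mul_finrank_centralizer_le [Fintype K] {τ : Family}
    (hN : τ = .sp → Even N) (hX : S.IsLineMatrix X) (hX' : X ∈ classicalLie τ N) :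
    (2 * Module.finrank ℂ (centralizer τ X) : ℤ) ≤
      ∑ k, ∑ k', (min (S.chain k).length (S.chain k').length : ℕ) +
        familySign τ * ∑ k, ((S.chain k).length % 2 : ℕ) := by
  classical
  obtain ⟨g, hg⟩ := hX.exists_isGauge
  have hle := LinearMap.finrank_le_finrank_of_injective (hg.coordinates_injective hX')
  have hfinrank := two_mul_finrank_equivariantFunctions (Diagonal.reflect_involutive (S := S))
    (hg.weight_reflect_mul_weight hN hX')
  have hsum : ∑ x : S.Diagonal with x.reflect = x, x.weight τ g =
      (familySign τ * ∑ k, ((S.chain k).length % 2 : ℕ) : ℤ) := by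
    rw [← sum_neg_one_pow_of_reflect_eq_self, mul_sum, Int.cast_sum]
    refine sum_congr rfl fun x hx => ?_
    rw [hg.weight_of_reflect_eq_self hN hX' (mem_filter.1 hx).2]
    push_cast
    rfl
  rw [hsum, Fintype.card_sigma, Fintype.sum_prod_type] at hfinrank
  simp only [Fintype.card_fin, ← Int.cast_natCast (R := ℂ)] at hfinrank
  rw [← Int.cast_add, ← Int.cast_ofNat, ← Int.cast_mul, Int.cast_inj] at hfinrank
  push_cast at hfinrank ⊢
  linarith

end ChainSystem

/-! ## Chains and blocks -/

namespace ChainSystem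

section Blocks

variable {d : List ℕ} {K : Type*} (S : ChainSystem d.sum K)

/-- The numbers of the blocks visited by a chain. -/
def blocks (k : K) : Finset ℕ := (S.chain k).toFinset.image (block d)

/-- The number of vertices of a chain in the central block. -/
def centralCard (k : K) : ℕ := #{v ∈ (S.chain k).toFinset | block d v = block d v.rev}

/-- The block numbers strictly increase along each chain. -/
def IsBlockIncreasing : Prop := ∀ k, ((S.chain k).map (block d)).Pairwise (· < ·)

variable {S}

theorem mem_blocks {k : K} {b : ℕ} : b ∈ S.blocks k ↔ ∃ v ∈ S.chain k, block d v = b := by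
  simp only [blocks, mem_image, List.mem_toFinset]

theorem IsBlockIncreasing.injOn_block (hS : S.IsBlockIncreasing) (k : K) :
    Set.InjOn (block d) (S.chain k).toFinset := by
  rw [List.coe_toFinset]
  exact List.inj_on_of_nodup_map ((hS k).imp ne_of_lt)

theorem IsBlockIncreasing.card_blocks (hS : S.IsBlockIncreasing) (k : K) :
    #(S.blocks k) = (S.chain k).length := by
  rw [blocks, card_image_of_injOn (hS.injOn_block k),
    List.toFinset_card_of_nodup (S.nodup_chain k)]

theorem IsBlockIncreasing.block_lt_of_line (hS : S.IsBlockIncreasing) {i j : Fin d.sum}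
    (h : S.Line i j) : block d i < block d j := by
  obtain ⟨k, a, ha, rfl, rfl⟩ := h
  have hlt := List.pairwise_iff_getElem.1 (hS k) a (a + 1)
    (by rw [List.length_map]; omega) (by rwa [List.length_map]) a.lt_succ_self
  rwa [List.getElem_map, List.getElem_map] at hlt

theorem IsLineMatrix.mem_nilradical {X : Matrix (Fin d.sum) (Fin d.sum) ℂ} {τ : Family}
    (hX : S.IsLineMatrix X) (hX' : X ∈ classicalLie τ d.sum) (hS : S.IsBlockIncreasing) :
    X ∈ nilradical τ d :=
  ⟨hX', fun _ _ h => hX.apply_eq_zero fun hline => (hS.block_lt_of_line hline).not_ge h⟩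

section Counting

variable [Fintype K]

theorem sum_centralCard (S : ChainSystem d.sum K) :
    ∑ k, S.centralCard k = #{v : Fin d.sum | block d v = block d v.rev} := by
  classical
  rw [card_eq_sum_card_fiberwise (f := S.label) (t := univ) fun _ _ => mem_coe.2 (mem_univ _)]
  refine sum_congr rfl fun k _ => congrArg card ?_
  ext v
  simp only [mem_filter, mem_univ, true_and, List.mem_toFinset, label_eq_iff, and_comm]

theorem sum_card_blocks_inter_le (S : ChainSystem d.sum K) :
    ∑ k, ∑ k', #(S.blocks k ∩ S.blocks k') ≤
      #{x : Fin d.sum × Fin d.sum | block d x.1 = block d x.2} := by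
  classical
  rw [card_eq_sum_card_fiberwise (f := fun x => (S.label x.1, S.label x.2)) (t := univ)
    fun _ _ => mem_coe.2 (mem_univ _), Fintype.sum_prod_type]
  refine sum_le_sum fun k _ => sum_le_sum fun k' _ => ?_
  refine (card_le_card fun b hb => ?_).trans (card_image_le (f := fun x => block d x.1))
  rw [mem_inter, mem_blocks, mem_blocks] at hb
  obtain ⟨⟨i, hi, rfl⟩, j, hj, hij⟩ := hb
  exact mem_image.2 ⟨(i, j), by simp [hij, label_eq_iff.2 hi, label_eq_iff.2 hj], rfl⟩

theorem two_mul_finrank_leviFactor {τ : Family} (hN : τ = .sp → Even d.sum)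
    (hd : d.reverse = d) (S : ChainSystem d.sum K) :
    (2 * Module.finrank ℂ (leviFactor τ d) : ℤ) =
      #{x : Fin d.sum × Fin d.sum | block d x.1 = block d x.2} +
        familySign τ * ∑ k, S.centralCard k := by
  have hrev := block_rev hd
  rw [leviFactor_eq_supported, two_mul_finrank_supported
    (fun i j _ => by have := hrev i; have := hrev j; omega) hN, ← S.sum_centralCard]

end Counting

theorem finrank_centralizer_le_finrank_leviFactor [Finite K] {X : Matrix (Fin d.sum) (Fin d.sum) ℂ}
    {τ : Family} (hX : S.IsLineMatrix X) (hX' : X ∈ classicalLie τ d.sum)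
    (hN : τ = .sp → Even d.sum) (hd : d.reverse = d)
    (hpair : ∀ k k', k' ≠ S.bar k →
      min (S.chain k).length (S.chain k').length ≤ #(S.blocks k ∩ S.blocks k'))
    (hself : ∀ k, ((S.chain k).length + familySign τ * ((S.chain k).length % 2 : ℕ) : ℤ) ≤
      #(S.blocks k ∩ S.blocks (S.bar k)) + familySign τ * S.centralCard k) :
    Module.finrank ℂ (centralizer τ X) ≤ Module.finrank ℂ (leviFactor τ d) := by
  classical
  cases nonempty_fintype K
  have hrow (k : K) : ∑ k', (min (S.chain k).length (S.chain k').length : ℕ) +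
      familySign τ * ((S.chain k).length % 2 : ℕ) ≤
      ∑ k', (#(S.blocks k ∩ S.blocks k') : ℤ) + familySign τ * S.centralCard k := by
    rw [← add_sum_erase _ _ (mem_univ (S.bar k)), ← add_sum_erase _ _ (mem_univ (S.bar k)),
      S.length_chain_bar, min_self]
    have hoff : ∑ k' ∈ univ.erase (S.bar k), min (S.chain k).length (S.chain k').length ≤
        ∑ k' ∈ univ.erase (S.bar k), #(S.blocks k ∩ S.blocks k') :=
      sum_le_sum fun k' hk' => hpair k k' (ne_of_mem_erase hk')
    have hself' := hself k
    zify at hoff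
    push_cast at hself' ⊢
    linarith
  have hrows := sum_le_sum fun k (_ : k ∈ univ) => hrow k
  have hbound := hX.two_mul_finrank_centralizer_le hN hX'
  have hlevi := two_mul_finrank_leviFactor hN hd S
  have hinter := Int.ofNat_le.2 S.sum_card_blocks_inter_le
  rw [sum_add_distrib, sum_add_distrib, ← mul_sum, ← mul_sum] at hrows
  push_cast at hbound hrows hlevi hinter
  linarith

end Blocks

/-! ## The matrix of a line diagram -/

theorem lineSign_rev {τ : Family} {N : ℕ} (hN : τ = .sp → Even N) {i j : Fin N}
    (hij : τ = .so → j ≠ i.rev) :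
    lineSign τ N (j.rev.val + 1) (i.rev.val + 1) =
      -(formSign τ i * formSign τ j) * lineSign τ N (i.val + 1) (j.val + 1) := by
  cases τ
  · have hsign (u v : Fin N) : lineSign .sp N (u.val + 1) (v.val + 1) = formSign .sp u := rfl
    rw [hsign, hsign, formSign_rev hN]
    simp only [familySign, Int.cast_one]
    linear_combination formSign .sp j * formSign_mul_self .sp i
  · have hne : i.val + j.val + 1 ≠ N := fun h =>
      hij rfl (Fin.ext (by rw [Fin.val_rev]; omega))
    simp only [lineSign, formSign, Fin.val_rev]
    split_ifs <;> first | omega | norm_num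

variable {K : Type*}

theorem not_line_rev {N : ℕ} {S : ChainSystem N K}
    (hS : ∀ k, S.bar k = k → (S.chain k).length = 0 ∨ Odd (S.chain k).length) (i : Fin N) :
    ¬ S.Line i i.rev := by
  rintro ⟨k, a, h, rfl, hrev⟩
  rw [S.rev_getElem_chain (Nat.lt_of_succ_lt h)] at hrev
  obtain ⟨hk, ha⟩ := eq_and_eq_of_getElem_chain_eq hrev
  rcases hS k hk.symm with hlen | ⟨m, hlen⟩ <;> omega

variable {τ : Family} {l : List ℕ} {c : Option ℕ} {S : ChainSystem (dimVector l c).sum K}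

theorem isLineMatrix_lineMatrix
    (hS : ∀ i j, (i.val + 1, j.val + 1) ∈ diagramLines τ l c ↔ S.Line i j) :
    S.IsLineMatrix (lineMatrix τ l c) where
  apply_eq_zero h := if_neg (mt (hS _ _).1 h)
  apply_mul_self h := by
    simp only [lineMatrix, Matrix.of_apply, if_pos ((hS _ _).2 h), lineSign]
    cases τ <;> split_ifs <;> norm_num

theorem lineMatrix_mem_classicalLie (hN : τ = .sp → Even (dimVector l c).sum)
    (hS : ∀ i j, (i.val + 1, j.val + 1) ∈ diagramLines τ l c ↔ S.Line i j)
    (hso : τ = .so → ∀ i, ¬ S.Line i i.rev) :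
    lineMatrix τ l c ∈ classicalLie τ (dimVector l c).sum := by
  refine (mem_classicalLie_iff _ _).2 fun i j => ?_
  have hrev : (j.rev.val + 1, i.rev.val + 1) ∈ diagramLines τ l c ↔
      (i.val + 1, j.val + 1) ∈ diagramLines τ l c := by
    rw [hS, hS, line_rev_iff]
  simp only [lineMatrix, Matrix.of_apply, hrev]
  split_ifs with h
  · exact lineSign_rev hN fun hτ hij => hso hτ i (hij ▸ (hS i j).1 h)
  · rw [mul_zero]

end ChainSystem

/-! ## Admissible chain systems -/

theorem reverse_dimVector (l : List ℕ) (c : Option ℕ) :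
    (dimVector l c).reverse = dimVector l c := by
  cases c <;> simp [dimVector]

namespace ChainSystem

section Blocks

variable {d : List ℕ} {K : Type*} {S : ChainSystem d.sum K}

theorem mem_blocks_bar (hd : d.reverse = d) {k : K} {b : ℕ} :
    b ∈ S.blocks (S.bar k) ↔ b < d.length ∧ d.length - 1 - b ∈ S.blocks k := by
  simp only [mem_blocks, S.chain_bar, List.mem_reverse, List.mem_map, exists_exists_and_eq_and]
  constructor
  · rintro ⟨v, hv, rfl⟩
    have hrev := block_rev hd v
    exact ⟨by omega, v, hv, by omega⟩
  · rintro ⟨hb, v, hv, hvb⟩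
    have hrev := block_rev hd v
    exact ⟨v, hv, by omega⟩

theorem IsBlockIncreasing.centralCard_eq (hS : S.IsBlockIncreasing) (hd : d.reverse = d) (k : K) :
    S.centralCard k = #{b ∈ S.blocks k | 2 * b + 1 = d.length} := by
  rw [centralCard, blocks, filter_image,
    card_image_of_injOn ((hS.injOn_block k).mono (coe_subset.2 (filter_subset _ _)))]
  refine congrArg card (filter_congr fun v _ => ?_)
  have hrev := block_rev hd v
  omega

theorem IsBlockIncreasing.centralCard_le_one (hS : S.IsBlockIncreasing) (hd : d.reverse = d)
    (k : K) : S.centralCard k ≤ 1 := by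
  rw [hS.centralCard_eq hd, card_le_one]
  intro b hb b' hb'
  have h := (mem_filter.1 hb).2
  have h' := (mem_filter.1 hb').2
  omega

theorem IsBlockIncreasing.card_blocks_inter_mod_two (hS : S.IsBlockIncreasing)
    (hd : d.reverse = d) (k : K) :
    #(S.blocks k ∩ S.blocks (S.bar k)) % 2 = S.centralCard k := by
  set I := S.blocks k ∩ S.blocks (S.bar k) with hI
  have hmem {b : ℕ} (hb : b ∈ I) : b < d.length ∧ d.length - 1 - b ∈ I := by
    simp only [hI, mem_inter, mem_blocks_bar hd] at hb ⊢
    obtain ⟨h, hlt, h'⟩ := hb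
    exact ⟨hlt, h', by omega, by rwa [show d.length - 1 - (d.length - 1 - b) = b by omega]⟩
  have hhalves : #{b ∈ I | 2 * b + 1 < d.length} = #{b ∈ I | d.length < 2 * b + 1} := by
    refine card_nbij' (d.length - 1 - ·) (d.length - 1 - ·) ?_ ?_ ?_ ?_ <;>
    · intro b hb
      simp only [coe_filter, Set.mem_ofPred_eq] at hb ⊢
      have hb' := hmem hb.1
      first | exact ⟨hb'.2, by omega⟩ | omega
  have hmiddle : #{b ∈ I | 2 * b + 1 = d.length} = S.centralCard k := by
    rw [hS.centralCard_eq hd]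
    congr 1
    ext b
    simp only [hI, mem_filter, mem_inter, mem_blocks_bar hd, and_congr_left_iff,
      and_iff_left_iff_imp]
    intro hb h
    exact ⟨by omega, by rwa [show d.length - 1 - b = b by omega]⟩
  have hsplit : #I = #{b ∈ I | 2 * b + 1 < d.length} + (#{b ∈ I | 2 * b + 1 = d.length} +
      #{b ∈ I | d.length < 2 * b + 1}) := by
    simp only [card_filter, card_eq_sum_ones I, ← sum_add_distrib]
    exact sum_congr rfl fun b _ => by split_ifs <;> omega
  have hle := hS.centralCard_le_one hd k
  omega

variable (S) in
/-- The combinatorial conditions on a system of chains under which twice the dimension of the Levi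
factor accounts for the whole centralizer: chains that are not mirror images of each other visit
nested sets of blocks, and a chain misses at most one block of its mirror image, in which case it
meets the central block exactly in the symplectic case. -/
structure IsAdmissible (τ : Family) : Prop where
  isBlockIncreasing : S.IsBlockIncreasing
  nested : ∀ k k', k' ≠ S.bar k → S.blocks k ⊆ S.blocks k' ∨ S.blocks k' ⊆ S.blocks k
  self_mirror : ∀ k, S.blocks k ⊆ S.blocks (S.bar k) ∨
    #(S.blocks k \ S.blocks (S.bar k)) ≤ 1 ∧ (S.centralCard k = 1 ↔ τ = .sp)
  centralCard_eq_one : τ = .so → ∀ k, S.bar k = k → S.chain k = [] ∨ S.centralCard k = 1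

namespace IsAdmissible

variable {τ : Family}

theorem min_length_le (hS : S.IsAdmissible τ) {k k' : K} (hk : k' ≠ S.bar k) :
    min (S.chain k).length (S.chain k').length ≤ #(S.blocks k ∩ S.blocks k') := by
  rw [← hS.isBlockIncreasing.card_blocks k, ← hS.isBlockIncreasing.card_blocks k']
  rcases hS.nested k k' hk with h | h
  · rw [inter_eq_left.2 h]
    exact min_le_left _ _
  · rw [inter_eq_right.2 h]
    exact min_le_right _ _

theorem length_add_le (hS : S.IsAdmissible τ) (hd : d.reverse = d) (k : K) :
    ((S.chain k).length + familySign τ * ((S.chain k).length % 2 : ℕ) : ℤ) ≤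
      #(S.blocks k ∩ S.blocks (S.bar k)) + familySign τ * S.centralCard k := by
  have hcard := card_inter_add_card_sdiff (S.blocks k) (S.blocks (S.bar k))
  rw [hS.isBlockIncreasing.card_blocks] at hcard
  have hmod := hS.isBlockIncreasing.card_blocks_inter_mod_two hd k
  rcases hS.self_mirror k with h | ⟨h, hτ⟩
  · rw [sdiff_eq_empty_iff_subset.2 h, card_empty, add_zero] at hcard
    rw [← hmod, hcard]
  · cases τ <;> simp only [familySign, iff_true, reduceCtorEq, iff_false] at hτ ⊢ <;> omega

theorem length_eq_zero_or_odd (hS : S.IsAdmissible .so) (hd : d.reverse = d) {k : K}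
    (hk : S.bar k = k) : (S.chain k).length = 0 ∨ Odd (S.chain k).length := by
  have hmod := hS.isBlockIncreasing.card_blocks_inter_mod_two hd k
  rw [hk, inter_self, hS.isBlockIncreasing.card_blocks] at hmod
  refine (hS.centralCard_eq_one rfl k hk).imp (fun h => by rw [h, List.length_nil]) fun h => ?_
  rw [Nat.odd_iff, hmod, h]

end IsAdmissible

end Blocks

section Restrict

variable {N : ℕ} {K : Type*} (S : ChainSystem N K)

/-- The same system without its empty chains; it has finitely many chains. -/
def restrict : ChainSystem N {k // S.chain k ≠ []} where
  chain k := S.chain k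
  bar k := ⟨S.bar k, by simpa [S.chain_bar] using k.2⟩
  nodup_chain k := S.nodup_chain k
  exists_mem_chain v :=
    let ⟨k, hk⟩ := S.exists_mem_chain v
    ⟨⟨k, List.ne_nil_of_mem hk⟩, hk⟩
  eq_of_mem_chain h h' := Subtype.ext (S.eq_of_mem_chain h h')
  bar_bar k := Subtype.ext (S.bar_bar k)
  chain_bar k := S.chain_bar k

instance : Finite {k // S.chain k ≠ []} :=
  Finite.of_surjective S.restrict.label fun k =>
    ⟨(S.chain k).head k.2, S.restrict.label_eq_iff.2 (List.head_mem k.2)⟩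

theorem restrict_line_iff {i j : Fin N} : S.restrict.Line i j ↔ S.Line i j :=
  ⟨fun ⟨k, a, h⟩ => ⟨k, a, h⟩, fun ⟨k, a, h, hij⟩ =>
    ⟨⟨k, List.ne_nil_of_length_pos (by omega)⟩, a, h, hij⟩⟩

theorem IsAdmissible.restrict {d : List ℕ} {S : ChainSystem d.sum K} {τ : Family}
    (hS : S.IsAdmissible τ) : S.restrict.IsAdmissible τ where
  isBlockIncreasing k := hS.isBlockIncreasing k
  nested k k' hk := hS.nested k k' fun h => hk (Subtype.ext h)
  self_mirror k := hS.self_mirror k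
  centralCard_eq_one hτ k hk := hS.centralCard_eq_one hτ k (congrArg Subtype.val hk)

end Restrict

variable {τ : Family} {l : List ℕ} {c : Option ℕ} {K : Type*}
  {S : ChainSystem (dimVector l c).sum K}

theorem IsAdmissible.isRichardson_lineMatrix (hS : S.IsAdmissible τ)
    (hN : τ = .sp → Even (dimVector l c).sum)
    (hline : ∀ i j, (i.val + 1, j.val + 1) ∈ diagramLines τ l c ↔ S.Line i j) :
    IsRichardson τ (dimVector l c) (lineMatrix τ l c) ∧
      Module.finrank ℂ (centralizer τ (lineMatrix τ l c)) =
        Module.finrank ℂ (leviFactor τ (dimVector l c)) := by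
  have hd := reverse_dimVector l c
  replace hS := hS.restrict
  replace hline i j := (hline i j).trans S.restrict_line_iff.symm
  have hX := isLineMatrix_lineMatrix hline
  have hX' := lineMatrix_mem_classicalLie hN hline fun hτ => by
    subst hτ
    exact not_line_rev fun k => hS.length_eq_zero_or_odd hd
  exact isRichardson_of_finrank_centralizer_le hN hd
    (hX.mem_nilradical hX' hS.isBlockIncreasing)
    (finrank_centralizer_le_finrank_leviFactor hX hX' hN hd (fun _ _ => hS.min_length_le)
      (hS.length_add_le hd))

end ChainSystem

/-! ## Positions in blocks -/

/-- The position `a` counted from the beginning of its block of sizes `d`. -/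
def blockOffset : List ℕ → ℕ → ℕ
  | [], a => a
  | x :: d, a => if a < x then a else blockOffset d (a - x)

theorem blockOffset_lt {d : List ℕ} {a : ℕ} (ha : a < d.sum) :
    blockOffset d a < d.getD (blockIndex d a) 0 := by
  induction d generalizing a with
  | nil => simp at ha
  | cons x d ih =>
    rw [List.sum_cons] at ha
    by_cases h : a < x
    · simp [blockOffset, blockIndex, h]
    · simpa [blockOffset, blockIndex, h] using ih (a := a - x) (by omega)

theorem exists_blockOffset_eq {d : List ℕ} {b j : ℕ} (hj : j < d.getD b 0) :
    ∃ a < d.sum, blockIndex d a = b ∧ blockOffset d a = j := by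
  induction d generalizing b with
  | nil => simp at hj
  | cons x d ih =>
    rw [List.sum_cons]
    cases b with
    | zero =>
      rw [List.getD_cons_zero] at hj
      exact ⟨j, by omega, by simp [blockIndex, hj], by simp [blockOffset, hj]⟩
    | succ b =>
      obtain ⟨a, ha, hb, hja⟩ := ih (List.getD_cons_succ ▸ hj)
      exact ⟨x + a, by omega, by simp [blockIndex, hb], by simp [blockOffset, hja]⟩

theorem blockIndex_mono (d : List ℕ) : Monotone (blockIndex d) := by
  induction d with
  | nil => exact fun _ _ _ => le_rfl
  | cons x d ih =>
    intro a a' h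
    simp only [blockIndex]
    split_ifs
    · exact le_rfl
    · exact Nat.zero_le _
    · omega
    · exact Nat.succ_le_succ (ih (by omega))

theorem eq_of_blockIndex_eq_of_blockOffset_eq {d : List ℕ} {a a' : ℕ}
    (h : blockIndex d a = blockIndex d a') (h' : blockOffset d a = blockOffset d a') : a = a' := by
  induction d generalizing a a' with
  | nil => exact h'
  | cons x d ih =>
    simp only [blockIndex, blockOffset] at h h'
    split_ifs at h h'
    · exact h'
    · have := ih (Nat.succ_injective h) h'
      omega

theorem blockOffset_append (d e : List ℕ) (a : ℕ) : blockOffset (d ++ e) a =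
    if a < d.sum then blockOffset d a else blockOffset e (a - d.sum) := by
  induction d generalizing a with
  | nil => simp
  | cons x d ih =>
    simp only [List.cons_append, blockOffset, ih, List.sum_cons]
    split_ifs <;> first | rfl | omega | rw [Nat.sub_sub]

theorem blockOffset_reverse {d : List ℕ} {a : ℕ} (ha : a < d.sum) :
    blockOffset d.reverse (d.sum - 1 - a) + blockOffset d a + 1 = d.getD (blockIndex d a) 0 := by
  induction d generalizing a with
  | nil => simp at ha
  | cons x d ih =>
    rw [List.sum_cons] at ha ⊢
    simp only [List.reverse_cons, blockOffset_append, List.sum_reverse, blockOffset, blockIndex]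
    by_cases h : a < x
    · rw [if_neg (by omega), if_pos (by omega), if_pos h, if_pos h, List.getD_cons_zero]
      omega
    · have := ih (a := a - x) (by omega)
      rw [if_pos (by omega), if_neg h, if_neg h, List.getD_cons_succ, ← this,
        show x + d.sum - 1 - a = d.sum - 1 - (a - x) by omega]

/-! ## Transversals of block decompositions -/

/-- The increasing list of the positions that lie at offset `f b` in their block `b`, for blocks of
sizes `d`; the value `none` of `f` skips the block. -/
def transversal (d : List ℕ) (f : ℕ → Option ℕ) : List ℕ :=
  (List.range d.sum).filter fun a => f (blockIndex d a) = some (blockOffset d a)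

theorem mem_transversal {d : List ℕ} {f : ℕ → Option ℕ} {a : ℕ} :
    a ∈ transversal d f ↔ a < d.sum ∧ f (blockIndex d a) = some (blockOffset d a) := by
  simp [transversal]

theorem transversal_append (d e : List ℕ) (f : ℕ → Option ℕ) : transversal (d ++ e) f =
    transversal d f ++ (transversal e fun b => f (d.length + b)).map (d.sum + ·) := by
  rw [transversal, List.sum_append, List.range_add, List.filter_append, List.filter_map]
  congr 1
  · refine List.filter_congr fun a ha => ?_
    rw [List.mem_range] at ha
    simp only [blockIndex_append, blockOffset_append, if_pos ha]
  · refine congrArg _ (List.filter_congr fun a _ => ?_)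
    simp [blockIndex_append, blockOffset_append, add_comm]

theorem transversal_singleton {x : ℕ} {f : ℕ → Option ℕ} (hf : ∀ j ∈ f 0, j < x) :
    transversal [x] f = (f 0).toList := by
  refine List.Pairwise.eq_of_mem_iff (r := (· < ·)) (List.pairwise_lt_range.filter _) ?_
    fun a => ?_
  · cases f 0 <;> simp
  · rw [mem_transversal, Option.mem_toList, List.sum_singleton]
    constructor
    · rintro ⟨ha, h⟩
      simpa only [blockIndex, blockOffset, if_pos ha] using h
    · intro h
      have ha := hf a h
      simpa only [blockIndex, blockOffset, if_pos ha] using ⟨ha, h⟩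

theorem transversal_reverse {d : List ℕ} {f g : ℕ → Option ℕ}
    (hfg : ∀ b < d.length, f (d.length - 1 - b) = (g b).map (d.getD b 0 - 1 - ·))
    (hg : ∀ b, ∀ j ∈ g b, j < d.getD b 0) :
    transversal d.reverse f = ((transversal d g).map (d.sum - 1 - ·)).reverse := by
  have hmem {a : ℕ} (ha : a < d.sum) :
      f (blockIndex d.reverse (d.sum - 1 - a)) = some (blockOffset d.reverse (d.sum - 1 - a)) ↔
        g (blockIndex d a) = some (blockOffset d a) := by
    have hindex := blockIndex_reverse ha
    have hoffset := blockOffset_reverse ha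
    rw [show blockIndex d.reverse (d.sum - 1 - a) = d.length - 1 - blockIndex d a by omega,
      hfg _ (blockIndex_lt ha), Option.map_eq_some_iff]
    constructor
    · rintro ⟨j, hj, hja⟩
      have hlt := hg _ j hj
      rw [hj, show j = blockOffset d a by omega]
    · exact fun h => ⟨_, h, by omega⟩
  refine List.Pairwise.eq_of_mem_iff (r := (· < ·)) (List.pairwise_lt_range.filter _) ?_
    fun a => ?_
  · rw [List.pairwise_reverse, List.pairwise_map]
    refine (List.pairwise_lt_range.filter _).imp_of_mem fun {a b} _ hb hab => ?_
    have hb' := List.mem_range.1 (List.mem_filter.1 hb).1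
    omega
  · rw [List.mem_reverse, List.mem_map, mem_transversal, List.sum_reverse]
    constructor
    · rintro ⟨ha, h⟩
      have heq : d.sum - 1 - (d.sum - 1 - a) = a := by omega
      exact ⟨d.sum - 1 - a, mem_transversal.2 ⟨by omega, (hmem (by omega)).1 (by rwa [heq])⟩, heq⟩
    · rintro ⟨a, ha, rfl⟩
      obtain ⟨ha, h⟩ := mem_transversal.1 ha
      exact ⟨by omega, (hmem ha).2 h⟩

/-- The labels of the vertices that a chain visits in the left columns, if it visits row `ρ x` of
each column of length `x`. -/
def leftChain (l : List ℕ) (ρ : ℕ → Option ℕ) : List ℕ :=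
  (columns 1 l).filterMap fun v => (ρ v.length).bind fun j => v[j]?

theorem length_mem_of_mem_columns {s : ℕ} {l v : List ℕ} (hv : v ∈ columns s l) :
    v.length ∈ l := by
  induction l generalizing s with
  | nil => simp [columns] at hv
  | cons x l ih =>
    rcases List.mem_cons.1 hv with rfl | hv
    · simp
    · exact List.mem_cons_of_mem x (ih hv)

theorem leftChain_eq_nil {l : List ℕ} {ρ : ℕ → Option ℕ} (hρ : ∀ x ∈ l, ρ x = none) :
    leftChain l ρ = [] :=
  List.filterMap_eq_nil_iff.2 fun v hv => by rw [hρ _ (length_mem_of_mem_columns hv)]; rfl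

theorem filterMap_columns (s : ℕ) (l : List ℕ) {ρ : ℕ → Option ℕ}
    (hρ : ∀ x, ∀ j ∈ ρ x, j < x) :
    (columns s l).filterMap (fun v => (ρ v.length).bind fun j => v[j]?) =
      (transversal l fun b => ρ (l.getD b 0)).map (s + ·) := by
  induction l generalizing s with
  | nil => simp [columns, transversal]
  | cons x l ih =>
    have hcolumn : ((ρ x).bind fun j => (List.range' s x)[j]?) = (ρ x).map (s + ·) := by
      rcases hx : ρ x with _ | j
      · rfl
      · simp [List.getElem?_range' (hρ x j hx)]
    rw [← List.singleton_append, transversal_append, List.map_append, List.map_map,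
      transversal_singleton (by simpa using hρ x)]
    simp only [List.singleton_append, columns, List.filterMap_cons, List.length_range', hcolumn, ih,
      List.length_singleton, add_comm 1, List.getD_cons_succ, List.getD_cons_zero,
      List.sum_singleton, Function.comp_def, ← add_assoc]
    cases ρ x <;> simp

/-! ## Chains given by a choice of rows -/

theorem sum_dimVector (l : List ℕ) (c : Option ℕ) :
    (dimVector l c).sum = 2 * l.sum + c.getD 0 := by
  cases c <;> simp [dimVector] <;> omega

theorem length_dimVector (l : List ℕ) (c : Option ℕ) :
    (dimVector l c).length = 2 * l.length + c.toList.length := by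
  simp only [dimVector, List.length_append, List.length_reverse]
  omega

theorem getD_dimVector_of_lt {l : List ℕ} (c : Option ℕ) {b : ℕ} (hb : b < l.length) :
    (dimVector l c).getD b 0 = l.getD b 0 := by
  rw [dimVector, List.append_assoc, List.getD_append _ _ _ _ hb]

theorem getD_dimVector_sub (l : List ℕ) (c : Option ℕ) {b : ℕ} (hb : b < (dimVector l c).length) :
    (dimVector l c).getD ((dimVector l c).length - 1 - b) 0 = (dimVector l c).getD b 0 := by
  conv_rhs => rw [← reverse_dimVector]
  rw [List.getD_eq_getElem _ _ (by omega), List.getD_eq_getElem _ _ (by simpa using hb),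
    List.getElem_reverse]

theorem left_or_centre_or_right {l : List ℕ} {c : Option ℕ} {b : ℕ}
    (hb : b < (dimVector l c).length) :
    b < l.length ∨ 2 * b + 1 = (dimVector l c).length ∨
      ∃ b' < l.length, (dimVector l c).length - 1 - b' = b := by
  have hlen := length_dimVector l c
  have hc : c.toList.length ≤ 1 := by cases c <;> simp
  by_cases hr : (dimVector l c).length - 1 - b < l.length
  · exact Or.inr (Or.inr ⟨_, hr, by omega⟩)
  · omega

theorem getD_dimVector_centre {l : List ℕ} {c : Option ℕ} {b : ℕ}
    (hb : 2 * b + 1 = (dimVector l c).length) : (dimVector l c).getD b 0 = c.getD 0 := by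
  rw [length_dimVector] at hb
  cases c with
  | none => simp at hb; omega
  | some c =>
    obtain rfl : b = l.length := by simp at hb; omega
    simp [dimVector]

/-- A symmetric system of chains for all dimension vectors with central entry `c`, in which a chain
meets a column in at most one vertex, whose row depends only on the length of the column: the chain
`k` visits row `row k x` (if any) of each left column of length `x`, and row `ctr k` (if any) of the
central column. The chain `bar k` is its mirror image. -/
structure RowSelection (c : Option ℕ) (K : Type*) where
  row : K → ℕ → Option ℕ
  ctr : K → Option ℕ
  bar : K → K
  bar_bar : ∀ k, bar (bar k) = k
  row_lt : ∀ k x, ∀ j ∈ row k x, j < x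
  exists_row_eq : ∀ x, ∀ j < x, ∃ k, row k x = some j
  eq_of_row_eq : ∀ x k k' j, row k x = some j → row k' x = some j → k = k'
  ctr_lt : ∀ k, ∀ j ∈ ctr k, j < c.getD 0
  exists_ctr_eq : ∀ j < c.getD 0, ∃ k, ctr k = some j
  eq_of_ctr_eq : ∀ k k' j, ctr k = some j → ctr k' = some j → k = k'
  ctr_bar : ∀ k, ctr (bar k) = (ctr k).map (c.getD 0 - 1 - ·)

namespace RowSelection

variable {l : List ℕ} {c : Option ℕ} {K : Type*} (R : RowSelection c K)

/-- The row (counted from `0`) of the block `b` that the chain `k` visits, if any, when the left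
columns have the lengths `l`. -/
def rowAt (l : List ℕ) (k : K) (b : ℕ) : Option ℕ :=
  if b < l.length then R.row k ((dimVector l c).getD b 0)
  else if 2 * b + 1 = (dimVector l c).length then R.ctr k
  else (R.row (R.bar k) ((dimVector l c).getD b 0)).map ((dimVector l c).getD b 0 - 1 - ·)

variable {R}

theorem rowAt_left {k : K} {b : ℕ} (hb : b < l.length) :
    R.rowAt l k b = R.row k ((dimVector l c).getD b 0) :=
  if_pos hb

theorem rowAt_centre {k : K} {b : ℕ} (hb : 2 * b + 1 = (dimVector l c).length) :
    R.rowAt l k b = R.ctr k := by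
  have hlen := length_dimVector l c
  have hc : c.toList.length ≤ 1 := by cases c <;> simp
  rw [rowAt, if_neg (by omega), if_pos hb]

theorem rowAt_right {k : K} {b : ℕ} (hb : b < l.length) :
    R.rowAt l k ((dimVector l c).length - 1 - b) = (R.row (R.bar k) ((dimVector l c).getD b 0)).map
      ((dimVector l c).getD b 0 - 1 - ·) := by
  have hlen := length_dimVector l c
  rw [rowAt, if_neg (by omega), if_neg (by omega), getD_dimVector_sub _ _ (by omega)]

theorem map_sub_map_sub_of_lt {o : Option ℕ} {n : ℕ} (ho : ∀ j ∈ o, j < n) :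
    (o.map (n - 1 - ·)).map (n - 1 - ·) = o := by
  rcases o with _ | j
  · rfl
  · have := ho j rfl
    simp only [Option.map_some, Option.some.injEq]
    omega

theorem rowAt_bar (k : K) {b : ℕ} (hb : b < (dimVector l c).length) :
    R.rowAt l (R.bar k) ((dimVector l c).length - 1 - b) =
      (R.rowAt l k b).map ((dimVector l c).getD b 0 - 1 - ·) := by
  rcases left_or_centre_or_right hb with h | h | ⟨b, h, rfl⟩
  · rw [rowAt_right h, rowAt_left h, R.bar_bar]
  · rw [show (dimVector l c).length - 1 - b = b by omega, rowAt_centre h, rowAt_centre h,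
      R.ctr_bar, getD_dimVector_centre h]
  · have hlen := length_dimVector l c
    rw [Nat.sub_sub_self (by omega), rowAt_left h, rowAt_right h, getD_dimVector_sub _ _ (by omega),
      map_sub_map_sub_of_lt (R.row_lt _ _)]

theorem rowAt_lt (k : K) (b : ℕ) : ∀ j ∈ R.rowAt l k b, j < (dimVector l c).getD b 0 := by
  intro j hj
  rw [rowAt] at hj
  split_ifs at hj with hl hc
  · exact R.row_lt _ _ _ hj
  · rw [getD_dimVector_centre hc]
    exact R.ctr_lt k j hj
  · obtain ⟨i, hi, rfl⟩ := Option.mem_map.1 hj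
    have := R.row_lt _ _ _ hi
    omega

theorem exists_rowAt_eq {b j : ℕ} (hj : j < (dimVector l c).getD b 0) :
    ∃ k, R.rowAt l k b = some j := by
  have hb : b < (dimVector l c).length := by
    by_contra h
    rw [List.getD_eq_default _ _ (by omega)] at hj
    omega
  rcases left_or_centre_or_right hb with h | h | ⟨b, h, rfl⟩
  · obtain ⟨k, hk⟩ := R.exists_row_eq _ j hj
    exact ⟨k, by rw [rowAt_left h, hk]⟩
  · obtain ⟨k, hk⟩ := R.exists_ctr_eq j (by rwa [getD_dimVector_centre h] at hj)
    exact ⟨k, by rw [rowAt_centre h, hk]⟩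
  · have hlen := length_dimVector l c
    rw [getD_dimVector_sub _ _ (by omega)] at hj
    obtain ⟨k, hk⟩ := R.exists_row_eq ((dimVector l c).getD b 0)
      ((dimVector l c).getD b 0 - 1 - j) (by omega)
    exact ⟨R.bar k, by
      rw [rowAt_right h, R.bar_bar, hk, Option.map_some, Nat.sub_sub_self (by omega)]⟩

theorem eq_of_rowAt_eq {k k' : K} {b j : ℕ} (hb : b < (dimVector l c).length)
    (h : R.rowAt l k b = some j) (h' : R.rowAt l k' b = some j) : k = k' := by
  have hleft {k k' : K} {b j : ℕ} (hb : b < l.length) (h : R.rowAt l k b = some j)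
      (h' : R.rowAt l k' b = some j) : k = k' :=
    R.eq_of_row_eq _ k k' j (rowAt_left hb ▸ h) (rowAt_left hb ▸ h')
  rcases left_or_centre_or_right hb with hl | hc | ⟨b', hr, rfl⟩
  · exact hleft hl h h'
  · exact R.eq_of_ctr_eq k k' j (rowAt_centre hc ▸ h) (rowAt_centre hc ▸ h')
  · have hlen := length_dimVector l c
    have hbar (k : K) := R.rowAt_bar k hb
    rw [Nat.sub_sub_self (by omega)] at hbar
    rw [← R.bar_bar k, ← R.bar_bar k',
      hleft hr ((hbar k).trans (congrArg _ h)) ((hbar k').trans (congrArg _ h'))]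

theorem transversal_rowAt_bar (k : K) : transversal (dimVector l c) (R.rowAt l (R.bar k)) =
    ((transversal (dimVector l c) (R.rowAt l k)).map ((dimVector l c).sum - 1 - ·)).reverse := by
  rw [← transversal_reverse (fun b hb => rowAt_bar k hb) (rowAt_lt k), reverse_dimVector]

variable (R l)

/-- The chain `k` through columns with left half `l`. -/
def chain (k : K) : List (Fin (dimVector l c).sum) :=
  (List.finRange _).filter fun v =>
    R.rowAt l k (block _ v) = some (blockOffset (dimVector l c) v)

variable {R l}

theorem mem_chain {k : K} {v : Fin (dimVector l c).sum} :
    v ∈ R.chain l k ↔ R.rowAt l k (block _ v) = some (blockOffset (dimVector l c) v) := by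
  simp [chain]

theorem map_val_chain (k : K) :
    (R.chain l k).map Fin.val = transversal (dimVector l c) (R.rowAt l k) := by
  rw [transversal, ← List.map_coe_finRange_eq_range, List.filter_map]
  rfl

theorem chain_bar (k : K) : R.chain l (R.bar k) = ((R.chain l k).map Fin.rev).reverse := by
  refine List.map_injective_iff.2 Fin.val_injective ?_
  rw [map_val_chain, transversal_rowAt_bar, ← map_val_chain, List.map_reverse, List.map_map,
    List.map_map]
  refine congrArg _ (List.map_congr_left fun v _ => ?_)
  simp only [Function.comp_apply, Fin.val_rev]
  omega

variable (R l) in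
/-- The chains of a row selection, as a system of chains. -/
def chainSystem : ChainSystem (dimVector l c).sum K where
  chain := R.chain l
  bar := R.bar
  nodup_chain _ := (List.nodup_finRange _).filter _
  exists_mem_chain v :=
    let ⟨k, hk⟩ := R.exists_rowAt_eq (blockOffset_lt v.isLt)
    ⟨k, mem_chain.2 hk⟩
  eq_of_mem_chain h h' :=
    eq_of_rowAt_eq (blockIndex_lt (Fin.isLt _)) (mem_chain.1 h) (mem_chain.1 h')
  bar_bar := R.bar_bar
  chain_bar := chain_bar

theorem isBlockIncreasing_chainSystem : (R.chainSystem l).IsBlockIncreasing := by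
  intro k
  rw [List.pairwise_map]
  refine ((List.pairwise_lt_finRange _).filter _).imp_of_mem fun {v w} hv hw hvw => ?_
  refine (blockIndex_mono _ hvw.le).lt_of_ne fun h => hvw.ne (Fin.ext ?_)
  refine eq_of_blockIndex_eq_of_blockOffset_eq h (Option.some_injective _ ?_)
  rw [← mem_chain.1 hv, ← mem_chain.1 hw, block, block, h]

theorem mem_blocks_chainSystem {k : K} {b : ℕ} :
    b ∈ (R.chainSystem l).blocks k ↔ (R.rowAt l k b).isSome := by
  rw [ChainSystem.mem_blocks, Option.isSome_iff_exists]
  constructor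
  · rintro ⟨v, hv, rfl⟩
    exact ⟨_, mem_chain.1 hv⟩
  · rintro ⟨j, hj⟩
    obtain ⟨a, ha, rfl, rfl⟩ := exists_blockOffset_eq (rowAt_lt k b j hj)
    exact ⟨⟨a, ha⟩, mem_chain.2 hj, rfl⟩

theorem centralCard_chainSystem_eq_one_iff {k : K} :
    (R.chainSystem l).centralCard k = 1 ↔ (R.ctr k).isSome := by
  have hd := reverse_dimVector l c
  have hS := R.isBlockIncreasing_chainSystem (l := l)
  have hle := hS.centralCard_le_one hd k
  rw [show (R.chainSystem l).centralCard k = 1 ↔ 0 < (R.chainSystem l).centralCard k by omega,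
    hS.centralCard_eq hd, card_pos]
  constructor
  · rintro ⟨b, hb⟩
    rw [mem_filter, mem_blocks_chainSystem] at hb
    rw [← rowAt_centre hb.2]
    exact hb.1
  · intro h
    have hlen : 2 * l.length + 1 = (dimVector l c).length := by
      obtain ⟨j, hj⟩ := Option.isSome_iff_exists.1 h
      have hlt := R.ctr_lt k j hj
      cases c <;> simp [length_dimVector] at hlt ⊢
    exact ⟨l.length, mem_filter.2 ⟨mem_blocks_chainSystem.2 (by rwa [rowAt_centre hlen]), hlen⟩⟩

variable (R l) in
/-- The labels of the vertices of the chain `k`. -/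
def labels (k : K) : List ℕ :=
  leftChain l (R.row k) ++ ((R.ctr k).map (l.sum + 1 + ·)).toList ++
    mirror (2 * l.sum + c.getD 0) (leftChain l (R.row (R.bar k)))

theorem transversal_centre (k : K) :
    transversal c.toList (fun b => R.rowAt l k (l.length + b)) = (R.ctr k).toList := by
  cases c with
  | none =>
    have hctr : R.ctr k = none := Option.eq_none_iff_forall_ne_some.2 fun j hj =>
      absurd (R.ctr_lt k j hj) (by simp)
    rw [hctr]
    rfl
  | some c =>
    have hlen : 2 * (l.length + 0) + 1 = (dimVector l (some c)).length := by
      simp [length_dimVector]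
    have hcentre : R.rowAt l k (l.length + 0) = R.ctr k := rowAt_centre hlen
    rw [Option.toList_some, transversal_singleton, hcentre]
    rw [hcentre]
    exact R.ctr_lt k

theorem map_succ_chain (k : K) : (R.chain l k).map (fun v => v.val + 1) = R.labels l k := by
  have hleft : transversal l (R.rowAt l k) = transversal l fun b => R.row k (l.getD b 0) :=
    List.filter_congr fun a ha => by
      have hlt := blockIndex_lt (List.mem_range.1 ha)
      rw [rowAt_left hlt, getD_dimVector_of_lt c hlt]
  have hright : transversal l.reverse (fun b => R.rowAt l k ((l ++ c.toList).length + b)) =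
      ((transversal l fun b => R.row (R.bar k) (l.getD b 0)).map (l.sum - 1 - ·)).reverse := by
    refine transversal_reverse (fun b hb => ?_) fun b => R.row_lt _ _
    rw [← getD_dimVector_of_lt c hb, ← rowAt_right hb, length_dimVector, List.length_append]
    congr 1
    omega
  have hcolumns (k : K) := filterMap_columns 1 l (R.row_lt k)
  have hdim : dimVector l c = l ++ c.toList ++ l.reverse := rfl
  rw [show (fun v : Fin (dimVector l c).sum => v.val + 1) = (1 + ·) ∘ Fin.val from
    funext fun v => add_comm _ _, ← List.map_map, map_val_chain, labels, leftChain, leftChain,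
    hcolumns, hcolumns, hdim, transversal_append, hright, transversal_append, transversal_centre,
    hleft]
  simp only [List.map_append, List.map_map, List.map_reverse, mirror]
  congr 2
  · cases R.ctr k <;> simp [add_comm]
  · refine List.map_congr_left fun a ha => ?_
    have hlt := (mem_transversal.1 ha).1
    have hcentre : c.toList.sum = c.getD 0 := by cases c <;> simp
    simp only [Function.comp_apply, List.sum_append, hcentre]
    omega

theorem mem_zip_tail {α : Type*} {L : List α} {x y : α} :
    (x, y) ∈ L.zip L.tail ↔ ∃ (a : ℕ) (h : a + 1 < L.length), L[a] = x ∧ L[a + 1] = y := by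
  rw [List.mem_iff_getElem]
  simp only [List.length_zip, List.length_tail, List.getElem_zip, List.getElem_tail, Prod.mk.injEq]
  exact exists_congr fun a => ⟨fun ⟨h, e⟩ => ⟨by omega, e⟩, fun ⟨h, e⟩ => ⟨by omega, e⟩⟩

variable (R l) in
/-- The chains of the row selection are the chains of the line diagram, up to empty ones. -/
def Draws (τ : Family) : Prop :=
  ∀ L ≠ [], L ∈ chains τ l c ↔ ∃ k, R.labels l k = L

theorem Draws.mem_diagramLines_iff {τ : Family} (hR : R.Draws l τ)
    {i j : Fin (dimVector l c).sum} :
    (i.val + 1, j.val + 1) ∈ diagramLines τ l c ↔ (R.chainSystem l).Line i j := by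
  have hzip {L : List ℕ} {p : ℕ × ℕ} (hp : p ∈ L.zip L.tail) : L ≠ [] := by
    rintro rfl
    simp at hp
  calc (i.val + 1, j.val + 1) ∈ diagramLines τ l c
    _ ↔ ∃ k, (i.val + 1, j.val + 1) ∈ (R.labels l k).zip (R.labels l k).tail := by
      rw [diagramLines, List.mem_flatMap]
      constructor
      · rintro ⟨L, hL, hp⟩
        obtain ⟨k, rfl⟩ := (hR L (hzip hp)).1 hL
        exact ⟨k, hp⟩
      · rintro ⟨k, hp⟩
        exact ⟨_, (hR _ (hzip hp)).2 ⟨k, rfl⟩, hp⟩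
    _ ↔ (R.chainSystem l).Line i j := by
      simp only [mem_zip_tail, ← map_succ_chain, List.length_map, List.getElem_map,
        Nat.add_right_cancel_iff, Fin.val_inj]
      rfl

variable (R l) in
/-- In columns with left half `l`, the chain `k` meets only columns that `k'` meets as well. -/
def Nested (k k' : K) : Prop :=
  (∀ x ∈ l, (R.row k x).isSome → (R.row k' x).isSome) ∧
    ((R.ctr k).isSome → (R.ctr k').isSome) ∧
    ∀ x ∈ l, (R.row (R.bar k) x).isSome → (R.row (R.bar k') x).isSome

theorem mem_blocks_left {k : K} {b : ℕ} (hb : b < l.length) :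
    b ∈ (R.chainSystem l).blocks k ↔ (R.row k l[b]).isSome := by
  rw [mem_blocks_chainSystem, rowAt_left hb, getD_dimVector_of_lt c hb, List.getD_eq_getElem _ _ hb]

theorem mem_blocks_right {k : K} {b : ℕ} (hb : b < l.length) :
    (dimVector l c).length - 1 - b ∈ (R.chainSystem l).blocks k ↔
      (R.row (R.bar k) l[b]).isSome := by
  rw [mem_blocks_chainSystem, rowAt_right hb, Option.isSome_map, getD_dimVector_of_lt c hb,
    List.getD_eq_getElem _ _ hb]

theorem mem_blocks_centre {k : K} {b : ℕ} (hb : 2 * b + 1 = (dimVector l c).length) :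
    b ∈ (R.chainSystem l).blocks k ↔ (R.ctr k).isSome := by
  rw [mem_blocks_chainSystem, rowAt_centre hb]

theorem lt_length_of_mem_blocks {k : K} {b : ℕ} (hb : b ∈ (R.chainSystem l).blocks k) :
    b < (dimVector l c).length := by
  obtain ⟨v, -, rfl⟩ := ChainSystem.mem_blocks.1 hb
  exact blockIndex_lt v.isLt

theorem Nested.blocks_subset {k k' : K} (h : R.Nested l k k') :
    (R.chainSystem l).blocks k ⊆ (R.chainSystem l).blocks k' := by
  intro b hb
  rcases left_or_centre_or_right (lt_length_of_mem_blocks hb) with hl | hc | ⟨b, hr, rfl⟩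
  · exact (mem_blocks_left hl).2 (h.1 _ (List.getElem_mem hl) ((mem_blocks_left hl).1 hb))
  · exact (mem_blocks_centre hc).2 (h.2.1 ((mem_blocks_centre hc).1 hb))
  · exact (mem_blocks_right hr).2 (h.2.2 _ (List.getElem_mem hr) ((mem_blocks_right hr).1 hb))

theorem getElem_inj_of_count_eq_one {x a b : ℕ} (hx : l.count x = 1) (ha : a < l.length)
    (hb : b < l.length) (hax : l[a] = x) (hbx : l[b] = x) : a = b := by
  by_contra hab
  wlog hlt : a < b generalizing a b
  · exact this hb ha hbx hax (Ne.symm hab) (by omega)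
  have hdup : List.Duplicate x l := List.duplicate_iff_exists_distinct_get.2
    ⟨⟨a, ha⟩, ⟨b, hb⟩, hlt, hax.symm, hbx.symm⟩
  have := List.duplicate_iff_two_le_count.1 hdup
  omega

theorem exists_of_mem_blocks_sdiff {k : K} {b : ℕ}
    (hb : b ∈ (R.chainSystem l).blocks k \ (R.chainSystem l).blocks (R.bar k)) :
    ∃ (a : ℕ) (ha : a < l.length),
      (b = a ∧ (R.row k l[a]).isSome ∧ ¬ (R.row (R.bar k) l[a]).isSome) ∨
      (b = (dimVector l c).length - 1 - a ∧
        ¬ (R.row k l[a]).isSome ∧ (R.row (R.bar k) l[a]).isSome) := by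
  rw [mem_sdiff] at hb
  rcases left_or_centre_or_right (lt_length_of_mem_blocks hb.1) with hl | hc | ⟨b, hr, rfl⟩
  · rw [mem_blocks_left hl, mem_blocks_left hl] at hb
    exact ⟨b, hl, Or.inl ⟨rfl, hb⟩⟩
  · rw [mem_blocks_centre hc, mem_blocks_centre hc, R.ctr_bar, Option.isSome_map] at hb
    exact absurd hb.1 hb.2
  · rw [mem_blocks_right hr, mem_blocks_right hr, R.bar_bar] at hb
    exact ⟨b, hr, Or.inr ⟨rfl, hb.2, hb.1⟩⟩

variable (R l) in
/-- The conditions on a row selection that make its chains an admissible system: chains that are not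
mirror images of each other are nested, and a chain and its mirror image meet the same columns,
except possibly for one left column whose length is not repeated. -/
structure IsAdmissible (τ : Family) : Prop where
  nested : ∀ k k', k' ≠ R.bar k → R.Nested l k k' ∨ R.Nested l k' k
  self_mirror : ∀ k, (∀ x ∈ l, (R.row k x).isSome = (R.row (R.bar k) x).isSome) ∨
    ∃ x₀, l.count x₀ = 1 ∧
      (∀ x ∈ l, x ≠ x₀ → (R.row k x).isSome = (R.row (R.bar k) x).isSome) ∧
      ((R.ctr k).isSome ↔ τ = .sp)
  ctr_isSome : τ = .so → ∀ k, R.bar k = k → R.labels l k = [] ∨ (R.ctr k).isSome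

theorem IsAdmissible.isAdmissible_chainSystem {τ : Family} (hR : R.IsAdmissible l τ) :
    (R.chainSystem l).IsAdmissible τ where
  isBlockIncreasing := isBlockIncreasing_chainSystem
  nested k k' hk :=
    (hR.nested k k' hk).imp Nested.blocks_subset Nested.blocks_subset
  self_mirror k := by
    refine (hR.self_mirror k).imp (fun h => ?_) fun ⟨x₀, hcount, hne, hτ⟩ => ⟨?_, ?_⟩
    · rw [← sdiff_eq_empty_iff_subset, eq_empty_iff_forall_notMem]
      intro b hb
      obtain ⟨a, ha, ⟨-, h₁, h₂⟩ | ⟨-, h₁, h₂⟩⟩ := exists_of_mem_blocks_sdiff hb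
      · exact h₂ (h _ (List.getElem_mem ha) ▸ h₁)
      · exact h₁ (h _ (List.getElem_mem ha) ▸ h₂)
    · rw [card_le_one]
      intro b hb b' hb'
      obtain ⟨a, ha, h⟩ := exists_of_mem_blocks_sdiff hb
      obtain ⟨a', ha', h'⟩ := exists_of_mem_blocks_sdiff hb'
      have heq {a : ℕ} (ha : a < l.length)
          (h : (R.row k l[a]).isSome ≠ (R.row (R.bar k) l[a]).isSome) : l[a] = x₀ :=
        not_imp_comm.1 (hne _ (List.getElem_mem ha)) h
      obtain rfl : a = a' := by
        refine getElem_inj_of_count_eq_one hcount ha ha' (heq ha ?_) (heq ha' ?_)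
        · rcases h with h | h <;> simp_all
        · rcases h' with h | h <;> simp_all
      rcases h with ⟨rfl, h, -⟩ | ⟨rfl, h, -⟩ <;> rcases h' with ⟨rfl, h', -⟩ | ⟨rfl, h', -⟩
      · rfl
      · exact absurd h h'
      · exact absurd h' h
      · rfl
    · rw [centralCard_chainSystem_eq_one_iff, hτ]
  centralCard_eq_one hτ k hk :=
    (hR.ctr_isSome hτ k hk).imp (fun h => List.map_eq_nil_iff.1 ((map_succ_chain k).trans h))
      centralCard_chainSystem_eq_one_iff.2

end RowSelection

/-! ## Diagrams of type (a) -/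

/-- The row selection whose chain `k` consists of row `k` of the left columns and of the mirror
image of row `σ k`. -/
def rowsSelection (σ : ℕ → ℕ) (hσ : ∀ k, σ (σ k) = k) : RowSelection none ℕ where
  row k x := if k < x then some k else none
  ctr _ := none
  bar := σ
  bar_bar := hσ
  row_lt k x j hj := by
    rw [Option.mem_def, Option.ite_none_right_eq_some, Option.some.injEq] at hj
    obtain ⟨h, rfl⟩ := hj
    exact h
  exists_row_eq x j hj := ⟨j, if_pos hj⟩
  eq_of_row_eq x k k' j h h' := by
    rw [Option.ite_none_right_eq_some, Option.some.injEq] at h h'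
    exact h.2.trans h'.2.symm
  ctr_lt _ _ h := by simp at h
  exists_ctr_eq j hj := absurd hj (Nat.not_lt_zero j)
  eq_of_ctr_eq _ _ _ h := by simp at h
  ctr_bar _ := rfl

section Rows

variable {σ : ℕ → ℕ} {hσ : ∀ k, σ (σ k) = k} {l : List ℕ}

theorem isSome_row_rowsSelection {k x : ℕ} : ((rowsSelection σ hσ).row k x).isSome ↔ k < x := by
  simp [rowsSelection]

theorem leftChain_rowsSelection (k : ℕ) :
    leftChain l ((rowsSelection σ hσ).row k) = row (columns 1 l) k :=
  List.filterMap_congr fun v _ => by by_cases h : k < v.length <;> simp [rowsSelection, h]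

theorem labels_rowsSelection (k : ℕ) : (rowsSelection σ hσ).labels l k =
    row (columns 1 l) k ++ mirror (2 * l.sum) (row (columns 1 l) (σ k)) := by
  rw [RowSelection.labels, leftChain_rowsSelection, leftChain_rowsSelection]
  simp [rowsSelection]

theorem row_columns_eq_nil {k : ℕ} (hk : l.sum ≤ k) : row (columns 1 l) k = [] := by
  rw [← leftChain_rowsSelection (σ := id) (hσ := fun _ => rfl)]
  exact leftChain_eq_nil fun x hx => if_neg ((List.le_sum_of_mem hx).trans hk).not_gt

theorem nested_rowsSelection {k k' : ℕ} (h : k' ≤ k) (hσk : σ k' ≤ σ k) :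
    (rowsSelection σ hσ).Nested l k k' := by
  have hmono {k k' x : ℕ} (h : k' ≤ k) (hx : ((rowsSelection σ hσ).row k x).isSome) :
      ((rowsSelection σ hσ).row k' x).isSome :=
    isSome_row_rowsSelection.2 (h.trans_lt (isSome_row_rowsSelection.1 hx))
  exact ⟨fun x _ => hmono h, id, fun x _ => hmono hσk⟩

end Rows

theorem draws_evenSp (l : List ℕ) : (rowsSelection id fun _ => rfl).Draws l .sp := by
  intro L hL
  simp only [chains, evenSp, labels_rowsSelection, List.mem_map, List.mem_range, id]
  refine ⟨fun ⟨k, _, h⟩ => ⟨k, h⟩, fun ⟨k, h⟩ => ⟨k, ?_, h⟩⟩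
  by_contra hk
  rw [row_columns_eq_nil (by omega)] at h
  exact hL h.symm

theorem isAdmissible_evenSp (l : List ℕ) :
    (rowsSelection id fun _ => rfl).IsAdmissible l .sp where
  nested k k' _ :=
    (le_total k' k).imp (fun h => nested_rowsSelection h h) fun h => nested_rowsSelection h h
  self_mirror _ := Or.inl fun _ _ => rfl
  ctr_isSome h := by simp at h

/-- The involution `2t ↔ 2t + 1`. -/
def swapPair (k : ℕ) : ℕ :=
  if k % 2 = 0 then k + 1 else k - 1

theorem swapPair_two_mul (t : ℕ) : swapPair (2 * t) = 2 * t + 1 := by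
  simp [swapPair]

theorem swapPair_two_mul_add_one (t : ℕ) : swapPair (2 * t + 1) = 2 * t := by
  simp [swapPair]

theorem swapPair_swapPair (k : ℕ) : swapPair (swapPair k) = k := by
  obtain ⟨t, rfl | rfl⟩ := k.even_or_odd' <;>
    simp only [swapPair_two_mul, swapPair_two_mul_add_one]

theorem draws_evenSo (l : List ℕ) : (rowsSelection swapPair swapPair_swapPair).Draws l .so := by
  intro L hL
  simp only [chains, evenSo, labels_rowsSelection, List.mem_flatMap, List.mem_range,
    List.mem_pair]
  constructor
  · rintro ⟨t, -, rfl | rfl⟩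
    · exact ⟨2 * t, by rw [swapPair_two_mul]⟩
    · exact ⟨2 * t + 1, by rw [swapPair_two_mul_add_one]⟩
  · rintro ⟨k, rfl⟩
    obtain ⟨t, hk⟩ := k.even_or_odd'
    refine ⟨t, ?_, ?_⟩
    · by_contra ht
      refine hL ?_
      rw [row_columns_eq_nil (by omega), row_columns_eq_nil (by rw [swapPair]; split_ifs <;> omega)]
      rfl
    · rcases hk with rfl | rfl
      · exact Or.inl (by rw [swapPair_two_mul])
      · exact Or.inr (by rw [swapPair_two_mul_add_one])

theorem isAdmissible_evenSo {l : List ℕ} (hl : IsSimple .so l none) :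
    (rowsSelection swapPair swapPair_swapPair).IsAdmissible l .so where
  nested k k' hk := by
    change k' ≠ swapPair k at hk
    have hcases : (k' ≤ k ∧ swapPair k' ≤ swapPair k) ∨ (k ≤ k' ∧ swapPair k ≤ swapPair k') := by
      simp only [swapPair] at hk ⊢
      split_ifs at hk ⊢ <;> omega
    exact hcases.imp (fun h => nested_rowsSelection h.1 h.2) fun h => nested_rowsSelection h.1 h.2
  self_mirror k := by
    set x₀ := max k (swapPair k) with hx₀
    have hdiff (x : ℕ) (hx : x ≠ x₀) :
        ((rowsSelection swapPair swapPair_swapPair).row k x).isSome =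
          ((rowsSelection swapPair swapPair_swapPair).row (swapPair k) x).isSome := by
      rw [Bool.eq_iff_iff, isSome_row_rowsSelection, isSome_row_rowsSelection]
      simp only [swapPair] at hx₀ ⊢
      split_ifs at hx₀ ⊢ <;> omega
    by_cases hmem : x₀ ∈ l
    · have hodd : Odd x₀ := by
        obtain ⟨t, rfl | rfl⟩ := k.even_or_odd'
        · exact ⟨t, by rw [hx₀, swapPair_two_mul]; omega⟩
        · exact ⟨t, by rw [hx₀, swapPair_two_mul_add_one]; omega⟩
      have hcount := hl x₀ (by simp [dimVector, hmem]) hodd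
      simp only [dimVector, Option.toList_none, List.append_nil, List.count_append,
        List.count_reverse] at hcount
      exact Or.inr ⟨x₀, by omega, fun x _ => hdiff x, by simp [rowsSelection]⟩
    · exact Or.inl fun x hx => hdiff x (ne_of_mem_of_not_mem hx hmem)
  ctr_isSome _ k hk := by
    change swapPair k = k at hk
    simp only [swapPair] at hk
    split_ifs at hk <;> omega

/-! ## Rounds of topmost and lowest vertices -/

/-- The column `v` without its vertex in row `s`, if any. -/
def offColumn {α : Type*} (s : Option ℕ) (v : List α) : List α :=
  s.elim v v.eraseIdx

theorem getElem?_offColumn {α : Type*} (s : Option ℕ) (v : List α) (t : ℕ) :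
    (offColumn s v)[t]? = (offColumn s (List.range v.length))[t]?.bind fun j => v[j]? := by
  have hrange (i : ℕ) : (List.range v.length)[i]?.bind (fun j => v[j]?) = v[i]? := by
    by_cases hi : i < v.length <;> simp [hi]
  cases s with
  | none => exact (hrange t).symm
  | some k =>
    simp only [offColumn, Option.elim_some, List.getElem?_eraseIdx]
    split_ifs <;> exact (hrange _).symm

theorem length_offColumn_range {α : Type*} (s : Option ℕ) (v : List α) :
    (offColumn s (List.range v.length)).length = (offColumn s v).length := by
  cases s <;> simp [offColumn, List.length_eraseIdx]

theorem mem_offColumn_range {s : Option ℕ} {x j : ℕ} :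
    j ∈ offColumn s (List.range x) ↔ j < x ∧ s ≠ some j := by
  cases s with
  | none => simp [offColumn]
  | some k =>
    simp only [offColumn, Option.elim_some, List.mem_eraseIdx_iff_getElem, List.length_range,
      List.getElem_range, ne_eq, Option.some.injEq]
    grind

theorem nodup_offColumn_range (s : Option ℕ) (x : ℕ) : (offColumn s (List.range x)).Nodup := by
  cases s with
  | none => exact List.nodup_range
  | some k => exact List.nodup_range.eraseIdx k

/-- The number of vertices of a column of length `x` off the chain that visits row `σ x` of it. -/
def offLength (σ : ℕ → Option ℕ) (x : ℕ) : ℕ :=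
  (offColumn (σ x) (List.range x)).length

theorem offLength_eq {σ : ℕ → Option ℕ} {x : ℕ} (hσ : ∀ j ∈ σ x, j < x) :
    offLength σ x = if (σ x).isSome then x - 1 else x := by
  rw [offLength]
  cases hx : σ x with
  | none => simp [offColumn]
  | some k => simp [offColumn, List.length_eraseIdx, hσ k hx]

/-- The row of a column of length `x` that a chain visits: row `σ x` for the chain `none`, and among
the other rows, the topmost for the chain `some (t, false)` and the lowest for the chain
`some (t, true)` after `t` rounds. -/
def roundRow (σ : ℕ → Option ℕ) : Option (ℕ × Bool) → ℕ → Option ℕ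
  | none, x => σ x
  | some (t, false), x =>
      if 2 * t + 1 ≤ offLength σ x then (offColumn (σ x) (List.range x))[t]? else none
  | some (t, true), x =>
      if 2 * t + 2 ≤ offLength σ x then (offColumn (σ x) (List.range x)).reverse[t]? else none

section RoundRow

variable {σ : ℕ → Option ℕ}

theorem roundRow_some_eq_some_iff {t : ℕ} {b : Bool} {x j : ℕ} :
    roundRow σ (some (t, b)) x = some j ↔ 2 * t + 1 + b.toNat ≤ offLength σ x ∧
      (offColumn (σ x) (List.range x))[bif b then offLength σ x - 1 - t else t]? = some j := by
  cases b with
  | false => simp only [roundRow, Option.ite_none_right_eq_some, Bool.toNat_false, add_zero,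
      cond_false]
  | true =>
    rw [roundRow, Option.ite_none_right_eq_some]
    refine and_congr_right fun h => ?_
    rw [List.getElem?_reverse (by rw [offLength] at h; omega)]
    rfl

theorem isSome_roundRow_some {t : ℕ} {b : Bool} {x : ℕ} :
    (roundRow σ (some (t, b)) x).isSome ↔ 2 * t + 1 + b.toNat ≤ offLength σ x := by
  simp only [Option.isSome_iff_exists, roundRow_some_eq_some_iff, exists_and_left]
  refine and_iff_left_of_imp fun h => ⟨_, List.getElem?_eq_getElem ?_⟩
  rw [← offLength]
  cases b <;> simp only [cond_true, cond_false] <;> omega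

theorem mem_of_roundRow_some_eq_some {t : ℕ} {b : Bool} {x j : ℕ}
    (h : roundRow σ (some (t, b)) x = some j) : j < x ∧ σ x ≠ some j :=
  mem_offColumn_range.1 (List.mem_of_getElem? (roundRow_some_eq_some_iff.1 h).2)

theorem roundRow_lt (hσ : ∀ x, ∀ j ∈ σ x, j < x) (k : Option (ℕ × Bool)) (x : ℕ) :
    ∀ j ∈ roundRow σ k x, j < x := by
  intro j hj
  rcases k with _ | ⟨t, b⟩
  · exact hσ x j hj
  · exact (mem_of_roundRow_some_eq_some hj).1

theorem exists_roundRow_eq {x j : ℕ} (hj : j < x) : ∃ k, roundRow σ k x = some j := by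
  by_cases hs : σ x = some j
  · exact ⟨none, hs⟩
  · obtain ⟨a, haj⟩ := List.mem_iff_getElem?.1 (mem_offColumn_range.2 ⟨hj, hs⟩)
    have ha : a < offLength σ x := (List.getElem?_eq_some_iff.1 haj).1
    by_cases htop : 2 * a + 1 ≤ offLength σ x
    · exact ⟨some (a, false), roundRow_some_eq_some_iff.2 ⟨htop, haj⟩⟩
    · refine ⟨some (offLength σ x - 1 - a, true), roundRow_some_eq_some_iff.2 ⟨?_, ?_⟩⟩
      · rw [Bool.toNat_true]
        omega
      · rw [cond_true, Nat.sub_sub_self (by omega), haj]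

theorem eq_of_roundRow_eq {x j : ℕ} {k k' : Option (ℕ × Bool)} (h : roundRow σ k x = some j)
    (h' : roundRow σ k' x = some j) : k = k' := by
  rcases k with _ | ⟨t, b⟩ <;> rcases k' with _ | ⟨t', b'⟩
  · rfl
  · exact absurd h (mem_of_roundRow_some_eq_some h').2
  · exact absurd h' (mem_of_roundRow_some_eq_some h).2
  · rw [roundRow_some_eq_some_iff] at h h'
    obtain ⟨hlt, hj⟩ := List.getElem?_eq_some_iff.1 h.2
    have hindex := (List.getElem?_inj hlt (nodup_offColumn_range _ _)).1 (h.2.trans h'.2.symm)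
    cases b <;> cases b' <;>
      simp only [cond_true, cond_false, Bool.toNat_true, Bool.toNat_false] at hindex h h' <;>
      simp <;> omega

theorem ite_getElem?_offColumn {α : Type*} (v : List α) (t : ℕ) :
    (if 2 * t + 1 ≤ (offColumn (σ v.length) v).length then (offColumn (σ v.length) v)[t]? else none)
      = (roundRow σ (some (t, false)) v.length).bind fun j => v[j]? := by
  rw [roundRow, offLength, length_offColumn_range, getElem?_offColumn]
  split_ifs <;> rfl

theorem ite_getElem?_reverse_offColumn {α : Type*} (v : List α) (t : ℕ) :
    (if 2 * t + 2 ≤ (offColumn (σ v.length) v).length then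
        (offColumn (σ v.length) v).reverse[t]? else none) =
      (roundRow σ (some (t, true)) v.length).bind fun j => v[j]? := by
  rw [roundRow, offLength, length_offColumn_range]
  split_ifs with h
  · have h' := length_offColumn_range (σ v.length) v
    rw [List.getElem?_reverse (by omega), List.getElem?_reverse (by omega), getElem?_offColumn, h']
  · rfl

theorem topmost_map_offColumn {l : List ℕ} (t : ℕ) :
    topmost ((columns 1 l).map fun v => offColumn (σ v.length) v) t =
      leftChain l (roundRow σ (some (t, false))) := by
  rw [topmost, List.filterMap_map]
  exact List.filterMap_congr fun v _ => ite_getElem?_offColumn v t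

theorem lowest_map_offColumn {l : List ℕ} (t : ℕ) :
    lowest ((columns 1 l).map fun v => offColumn (σ v.length) v) t =
      leftChain l (roundRow σ (some (t, true))) := by
  rw [lowest, List.filterMap_map]
  exact List.filterMap_congr fun v _ => ite_getElem?_reverse_offColumn v t

end RoundRow

/-! ## Diagrams of type (b) -/

/-- The middle row of a column of length `x`, if there is one. -/
def middleRow (x : ℕ) : Option ℕ :=
  if Odd x then some (x / 2) else none

theorem middleRow_eq_some_iff {x j : ℕ} : middleRow x = some j ↔ x = 2 * j + 1 := by
  rw [middleRow, Option.ite_none_right_eq_some, Nat.odd_iff, Option.some.injEq]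
  omega

theorem isSome_middleRow {x : ℕ} : (middleRow x).isSome ↔ Odd x := by
  simp [middleRow]

theorem middleRow_lt (x : ℕ) : ∀ j ∈ middleRow x, j < x := by
  intro j hj
  rw [middleRow_eq_some_iff.1 hj]
  omega

theorem offLength_middleRow (x : ℕ) : offLength middleRow x = 2 * (x / 2) := by
  simp only [offLength_eq (middleRow_lt x), isSome_middleRow, Nat.odd_iff]
  split_ifs <;> omega

theorem isSome_roundRow_middleRow {t : ℕ} {b : Bool} {c : ℕ} :
    (roundRow middleRow (some (t, b)) c).isSome ↔ 2 * t + 2 ≤ c := by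
  rw [isSome_roundRow_some, offLength_middleRow]
  cases b <;> simp only [Bool.toNat_false, Bool.toNat_true] <;> omega

theorem roundRow_middleRow (t : ℕ) (b : Bool) (c : ℕ) :
    roundRow middleRow (some (t, b)) c =
      if 2 * t + 2 ≤ c then some (bif b then c - 1 - t else t) else none := by
  split_ifs with h
  · have hrange {j : ℕ} (hj : j < c) : (List.range c)[j]? = some j := by simp [hj]
    refine roundRow_some_eq_some_iff.2 ⟨?_, ?_⟩
    · rw [offLength_middleRow]
      cases b <;> simp only [Bool.toNat_false, Bool.toNat_true] <;> omega
    · rw [offLength_middleRow]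
      by_cases hc : Odd c
      · have hc' := Nat.odd_iff.1 hc
        rw [middleRow, if_pos hc, offColumn, Option.elim_some, List.getElem?_eraseIdx]
        cases b <;> simp only [cond_true, cond_false]
        · rw [if_pos (by omega), hrange (by omega)]
        · rw [if_neg (by omega), hrange (by omega)]
          exact congrArg _ (by omega)
      · have hc' := Nat.not_odd_iff.1 hc
        rw [middleRow, if_neg hc, offColumn, Option.elim_none]
        cases b <;> simp only [cond_true, cond_false]
        · rw [hrange (by omega)]
        · rw [hrange (by omega)]
          exact congrArg _ (by omega)
  · rw [← Option.not_isSome_iff_eq_none, isSome_roundRow_middleRow]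
    exact h

/-- The chain to which the chain `k` is joined in the centre, mirrored: the chain itself, or in the
rounds `t` with `flip t`, the one through the vertices at the opposite ends of the columns. -/
def roundBar (flip : ℕ → Bool) : Option (ℕ × Bool) → Option (ℕ × Bool) :=
  Option.map fun k => (k.1, k.2 ^^ flip k.1)

/-- The row selection drawn by one chain with rows `σ` through the middle of the central column,
if this has odd length, and by rounds joining the topmost and the lowest of the other vertices.
In the rounds `t` with `flip t` the topmost vertices on the left are joined to the lowest ones on
the right, in the remaining ones to the topmost ones. -/
def roundSelection (c : ℕ) (σ : ℕ → Option ℕ) (hσ : ∀ x, ∀ j ∈ σ x, j < x) (flip : ℕ → Bool)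
    (hflip : ∀ t, 2 * t + 2 ≤ c → flip t = true) :
    RowSelection (some c) (Option (ℕ × Bool)) where
  row := roundRow σ
  ctr k := roundRow middleRow k c
  bar := roundBar flip
  bar_bar k := by rcases k with _ | ⟨t, b⟩ <;> simp [roundBar]
  row_lt := roundRow_lt hσ
  exists_row_eq _ _ := exists_roundRow_eq
  eq_of_row_eq _ _ _ _ := eq_of_roundRow_eq
  ctr_lt k := roundRow_lt middleRow_lt k c
  exists_ctr_eq _ := exists_roundRow_eq
  eq_of_ctr_eq _ _ _ := eq_of_roundRow_eq
  ctr_bar k := by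
    rcases k with _ | ⟨t, b⟩
    · by_cases hc : Odd c
      · have hc' := Nat.odd_iff.1 hc
        simp only [roundBar, Option.map_none, roundRow, middleRow, if_pos hc, Option.map_some,
          Option.getD_some, Option.some.injEq]
        omega
      · simp [roundBar, roundRow, middleRow, hc]
    · simp only [roundBar, Option.map_some, roundRow_middleRow, Option.getD_some]
      split_ifs with h
      · rw [hflip t h]
        cases b <;> simp
        omega
      · rfl

section Rounds

variable {c : ℕ} {σ : ℕ → Option ℕ} {hσ : ∀ x, ∀ j ∈ σ x, j < x} {flip : ℕ → Bool}
  {hflip : ∀ t, 2 * t + 2 ≤ c → flip t = true} {l : List ℕ}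

/-- The chains drawn in round `t` through the columns `C` on the left and the central column `Z` of
a diagram with `N` vertices, where `c` is the length of the central column of the full diagram. -/
def roundChains (c : ℕ) (flip : ℕ → Bool) (N : ℕ) (C : List (List ℕ)) (Z : List ℕ) (t : ℕ) :
    List (List ℕ) :=
  if 2 * t + 2 ≤ c then throughCentre N C Z t
  else if flip t then acrossCentre N C t
  else [topmost C t ++ mirror N (topmost C t), lowest C t ++ mirror N (lowest C t)]

theorem map_ctr_roundSelection (k : Option (ℕ × Bool)) :
    ((roundSelection c σ hσ flip hflip).ctr k).map (l.sum + 1 + ·) =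
      (roundRow middleRow k c).bind fun j => (List.range' (l.sum + 1) c)[j]? := by
  change (roundRow middleRow k c).map _ = _
  rcases hk : roundRow middleRow k c with _ | j
  · rfl
  · simp [List.getElem?_range' (roundRow_lt middleRow_lt k c j hk)]

theorem getElem?_centre {t : ℕ} (h : 2 * t + 2 ≤ c) :
    (offColumn (middleRow c) (List.range' (l.sum + 1) c))[t]? =
        ((roundSelection c σ hσ flip hflip).ctr (some (t, false))).map (l.sum + 1 + ·) ∧
      (offColumn (middleRow c) (List.range' (l.sum + 1) c)).reverse[t]? =
        ((roundSelection c σ hσ flip hflip).ctr (some (t, true))).map (l.sum + 1 + ·) := by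
  have htop := ite_getElem?_offColumn (σ := middleRow) (List.range' (l.sum + 1) c) t
  have hlow := ite_getElem?_reverse_offColumn (σ := middleRow) (List.range' (l.sum + 1) c) t
  have hlen : 2 * t + 2 ≤ (offColumn (middleRow c) (List.range' (l.sum + 1) c)).length := by
    have := offLength_middleRow c
    rw [offLength] at this
    have := length_offColumn_range (middleRow c) (List.range' (l.sum + 1) c)
    rw [List.length_range'] at this
    omega
  rw [List.length_range'] at htop hlow
  rw [if_pos (by omega)] at htop
  rw [if_pos hlen] at hlow
  rw [map_ctr_roundSelection, map_ctr_roundSelection]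
  exact ⟨htop, hlow⟩

theorem labels_roundSelection (t : ℕ) :
    [(roundSelection c σ hσ flip hflip).labels l (some (t, false)),
      (roundSelection c σ hσ flip hflip).labels l (some (t, true))] =
    roundChains c flip (2 * l.sum + c) ((columns 1 l).map fun v => offColumn (σ v.length) v)
      (offColumn (middleRow c) (List.range' (l.sum + 1) c)) t := by
  have hrow (b : Bool) : (roundSelection c σ hσ flip hflip).row (some (t, b)) =
      roundRow σ (some (t, b)) := rfl
  have hbar (b : Bool) : (roundSelection c σ hσ flip hflip).bar (some (t, b)) =
      some (t, b ^^ flip t) := rfl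
  simp only [RowSelection.labels, hbar, hrow, roundChains, throughCentre, acrossCentre,
    topmost_map_offColumn, lowest_map_offColumn, Option.getD_some]
  split_ifs with hc hf
  · obtain ⟨htop, hlow⟩ := getElem?_centre (hσ := hσ) (hflip := hflip) (l := l) hc
    simp only [htop, hlow, hflip t hc, Bool.xor_true, Bool.not_false, Bool.not_true]
  all_goals
    have hctr (b : Bool) : (roundSelection c σ hσ flip hflip).ctr (some (t, b)) = none :=
      Option.not_isSome_iff_eq_none.1 (mt isSome_roundRow_middleRow.1 hc)
    simp [hctr, hf]

theorem isSome_row_roundSelection {t : ℕ} {b : Bool} {x : ℕ} :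
    ((roundSelection c σ hσ flip hflip).row (some (t, b)) x).isSome ↔
      2 * t + 1 + b.toNat ≤ offLength σ x :=
  isSome_roundRow_some

theorem isSome_row_bar_roundSelection {t : ℕ} {b : Bool} {x : ℕ} :
    ((roundSelection c σ hσ flip hflip).row
      ((roundSelection c σ hσ flip hflip).bar (some (t, b))) x).isSome ↔
      2 * t + 1 + (b ^^ flip t).toNat ≤ offLength σ x :=
  isSome_roundRow_some

theorem isSome_ctr_roundSelection {t : ℕ} {b : Bool} :
    ((roundSelection c σ hσ flip hflip).ctr (some (t, b))).isSome ↔ 2 * t + 2 ≤ c :=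
  isSome_roundRow_middleRow

theorem isSome_ctr_none_roundSelection :
    ((roundSelection c σ hσ flip hflip).ctr none).isSome ↔ Odd c :=
  isSome_middleRow

theorem nested_roundSelection_of_le {t t' : ℕ} {b b' : Bool}
    (h : 2 * t' + b'.toNat ≤ 2 * t + b.toNat)
    (hbar : 2 * t' + (b' ^^ flip t').toNat ≤ 2 * t + (b ^^ flip t).toNat) :
    (roundSelection c σ hσ flip hflip).Nested l (some (t, b)) (some (t', b')) := by
  refine ⟨fun x _ => ?_, ?_, fun x _ => ?_⟩
  · rw [isSome_row_roundSelection, isSome_row_roundSelection]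
    omega
  · have := b.toNat_lt
    rw [isSome_ctr_roundSelection, isSome_ctr_roundSelection]
    omega
  · rw [isSome_row_bar_roundSelection, isSome_row_bar_roundSelection]
    omega

theorem nested_roundSelection {t t' : ℕ} {b b' : Bool}
    (h : (t', b') ≠ (t, b ^^ flip t)) :
    (roundSelection c σ hσ flip hflip).Nested l (some (t, b)) (some (t', b')) ∨
      (roundSelection c σ hσ flip hflip).Nested l (some (t', b')) (some (t, b)) := by
  have hle {t t' : ℕ} {a a' : Bool} (h : t < t') : 2 * t + a.toNat ≤ 2 * t' + a'.toNat := by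
    have := a.toNat_lt
    omega
  rcases lt_trichotomy t t' with ht | rfl | ht
  · exact Or.inr (nested_roundSelection_of_le (hle ht) (hle ht))
  · have hb : b' ≠ (b ^^ flip t) := fun hb => h (by rw [hb])
    have hcases : (b' ≤ b ∧ (b' ^^ flip t) ≤ (b ^^ flip t)) ∨
        (b ≤ b' ∧ (b ^^ flip t) ≤ (b' ^^ flip t)) := by
      clear h
      revert hb
      generalize flip t = f
      revert b b' f
      decide
    have hmono {a a' : Bool} (h : a ≤ a') : 2 * t + a.toNat ≤ 2 * t + a'.toNat :=
      Nat.add_le_add_left (Bool.toNat_le_toNat h) _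
    exact hcases.imp (fun h => nested_roundSelection_of_le (hmono h.1) (hmono h.2)) fun h =>
      nested_roundSelection_of_le (hmono h.1) (hmono h.2)
  · exact Or.inl (nested_roundSelection_of_le (hle ht) (hle ht))

theorem labels_none_roundSelection (hc : Odd c) :
    (roundSelection c σ hσ flip hflip).labels l none =
      leftChain l σ ++ [l.sum + 1 + c / 2] ++ mirror (2 * l.sum + c) (leftChain l σ) := by
  change leftChain l σ ++ ((middleRow c).map (l.sum + 1 + ·)).toList ++ mirror _ (leftChain l σ) = _
  rw [middleRow, if_pos hc]
  rfl

theorem labels_none_roundSelection_eq_nil (hc : ¬ Odd c) (hspine : ∀ x, σ x = none) :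
    (roundSelection c σ hσ flip hflip).labels l none = [] := by
  change leftChain l σ ++ ((middleRow c).map (l.sum + 1 + ·)).toList ++ mirror _ (leftChain l σ) = _
  rw [middleRow, if_neg hc, leftChain_eq_nil fun x _ => hspine x]
  rfl

theorem labels_roundSelection_eq_nil {t : ℕ} (ht : 2 * l.sum + c ≤ t) (b : Bool) :
    (roundSelection c σ hσ flip hflip).labels l (some (t, b)) = [] := by
  have hrow (b : Bool) : leftChain l ((roundSelection c σ hσ flip hflip).row (some (t, b))) = [] :=
    leftChain_eq_nil fun x hx => by
      have hxl := List.le_sum_of_mem hx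
      have hoff : offLength σ x ≤ x := by
        rw [offLength_eq (hσ x)]
        split_ifs <;> omega
      rw [← Option.not_isSome_iff_eq_none, isSome_row_roundSelection]
      omega
  have hctr : (roundSelection c σ hσ flip hflip).ctr (some (t, b)) = none := by
    rw [← Option.not_isSome_iff_eq_none, isSome_ctr_roundSelection]
    omega
  change leftChain l _ ++ Option.toList (Option.map _ _) ++ mirror _ (leftChain l _) = []
  rw [hrow, hctr]
  exact congrArg (mirror _) (hrow (b ^^ flip t))

theorem draws_roundSelection {τ : Family} (hspine : ¬ Odd c → ∀ x, σ x = none)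
    (hchains : chains τ l (some c) =
      (if Odd c then
        [leftChain l σ ++ [l.sum + 1 + c / 2] ++ mirror (2 * l.sum + c) (leftChain l σ)] else []) ++
      (List.range (2 * l.sum + c)).flatMap (roundChains c flip (2 * l.sum + c)
        ((columns 1 l).map fun v => offColumn (σ v.length) v)
        (offColumn (middleRow c) (List.range' (l.sum + 1) c)))) :
    (roundSelection c σ hσ flip hflip).Draws l τ := by
  intro L hL
  have hround (t : ℕ) := labels_roundSelection (hσ := hσ) (hflip := hflip) (l := l) t
  simp only [hchains, List.mem_append, List.mem_flatMap, List.mem_range, ← hround, List.mem_pair]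
  constructor
  · rintro (h | ⟨t, -, rfl | rfl⟩)
    · split_ifs at h with hc
      · exact ⟨none, (labels_none_roundSelection hc).trans (List.mem_singleton.1 h).symm⟩
      · simp at h
    · exact ⟨_, rfl⟩
    · exact ⟨_, rfl⟩
  · rintro ⟨_ | ⟨t, b⟩, rfl⟩
    · left
      by_cases hc : Odd c
      · rw [if_pos hc, labels_none_roundSelection hc]
        exact List.mem_singleton_self _
      · exact absurd (labels_none_roundSelection_eq_nil hc (hspine hc)) hL
    · right
      refine ⟨t, ?_, ?_⟩
      · by_contra ht
        exact hL (labels_roundSelection_eq_nil (by omega) b)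
      · cases b <;> simp

theorem isSome_row_eq_isSome_row_bar_iff {t : ℕ} {b : Bool} {x : ℕ} (ht : flip t = true) :
    ((roundSelection c σ hσ flip hflip).row (some (t, b)) x).isSome =
      ((roundSelection c σ hσ flip hflip).row
        ((roundSelection c σ hσ flip hflip).bar (some (t, b))) x).isSome ↔
      offLength σ x ≠ 2 * t + 1 := by
  rw [Bool.eq_iff_iff, isSome_row_roundSelection, isSome_row_bar_roundSelection, ht]
  cases b <;>
    simp only [Bool.xor_true, Bool.not_true, Bool.not_false, Bool.toNat_true, Bool.toNat_false] <;>
    omega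

theorem nested_none_roundSelection {t : ℕ} (b : Bool)
    (h : ((∀ x ∈ l, (σ x).isSome → 2 * t + 2 ≤ offLength σ x) ∧ (Odd c → 2 * t + 2 ≤ c)) ∨
      ((∀ x ∈ l, 2 * t + 1 ≤ offLength σ x → (σ x).isSome) ∧ (2 * t + 2 ≤ c → Odd c))) :
    (roundSelection c σ hσ flip hflip).Nested l none (some (t, b)) ∨
      (roundSelection c σ hσ flip hflip).Nested l (some (t, b)) none := by
  refine h.imp (fun ⟨hleft, hctr⟩ => ⟨fun x hx hs => ?_, ?_, fun x hx hs => ?_⟩)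
    fun ⟨hleft, hctr⟩ => ⟨fun x hx hs => hleft x hx ?_, ?_, fun x hx hs => hleft x hx ?_⟩
  · have := hleft x hx hs
    have := b.toNat_lt
    rw [isSome_row_roundSelection]
    omega
  · rwa [isSome_ctr_none_roundSelection, isSome_ctr_roundSelection]
  · have := hleft x hx hs
    have := (b ^^ flip t).toNat_lt
    rw [isSome_row_bar_roundSelection]
    omega
  · rw [isSome_row_roundSelection] at hs
    omega
  · rwa [isSome_ctr_none_roundSelection, isSome_ctr_roundSelection]
  · rw [isSome_row_bar_roundSelection] at hs
    omega

theorem isAdmissible_roundSelection {τ : Family} (hspine : ¬ Odd c → ∀ x, σ x = none)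
    (hτ : τ = .so → ∀ t, flip t = true)
    (hnested : ∀ t,
      ((∀ x ∈ l, (σ x).isSome → 2 * t + 2 ≤ offLength σ x) ∧ (Odd c → 2 * t + 2 ≤ c)) ∨
      ((∀ x ∈ l, 2 * t + 1 ≤ offLength σ x → (σ x).isSome) ∧ (2 * t + 2 ≤ c → Odd c)))
    (hself : ∀ t, flip t = true → (∀ x ∈ l, offLength σ x ≠ 2 * t + 1) ∨
      ∃ x₀, l.count x₀ = 1 ∧ (∀ x ∈ l, x ≠ x₀ → offLength σ x ≠ 2 * t + 1) ∧
        (2 * t + 2 ≤ c ↔ τ = .sp)) :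
    (roundSelection c σ hσ flip hflip).IsAdmissible l τ where
  nested k k' hk := by
    rcases k with _ | ⟨t, b⟩ <;> rcases k' with _ | ⟨t', b'⟩
    · exact absurd rfl hk
    · exact nested_none_roundSelection b' (hnested t')
    · exact (nested_none_roundSelection b (hnested t)).symm
    · exact nested_roundSelection fun h => hk (congrArg some h)
  self_mirror k := by
    rcases k with _ | ⟨t, b⟩
    · exact Or.inl fun _ _ => rfl
    · rcases hf : flip t
      · refine Or.inl fun x _ => ?_
        rw [Bool.eq_iff_iff, isSome_row_roundSelection, isSome_row_bar_roundSelection, hf,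
          Bool.xor_false]
      · simp only [isSome_row_eq_isSome_row_bar_iff hf, isSome_ctr_roundSelection]
        exact hself t hf
  ctr_isSome hso k hk := by
    rcases k with _ | ⟨t, b⟩
    · by_cases hc : Odd c
      · exact Or.inr (isSome_ctr_none_roundSelection.2 hc)
      · exact Or.inl (labels_none_roundSelection_eq_nil hc (hspine hc))
    · change some (t, b ^^ flip t) = some (t, b) at hk
      rw [hτ hso] at hk
      simp at hk

end Rounds

/-- The row selection of a diagram of type (b) that is drawn in rounds only. -/
def plainSelection (c : ℕ) (flip : ℕ → Bool) (hflip : ∀ t, 2 * t + 2 ≤ c → flip t = true) :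
    RowSelection (some c) (Option (ℕ × Bool)) :=
  roundSelection c (fun _ => none) (fun _ _ h => by simp at h) flip hflip

section Plain

variable {c : ℕ} {flip : ℕ → Bool} {hflip : ∀ t, 2 * t + 2 ≤ c → flip t = true} {l : List ℕ}
  {τ : Family}

theorem draws_plainSelection (hc : ¬ Odd c)
    (hchains : chains τ l (some c) = (List.range (2 * l.sum + c)).flatMap
      (roundChains c flip (2 * l.sum + c) (columns 1 l) (List.range' (l.sum + 1) c))) :
    (plainSelection c flip hflip).Draws l τ := by
  refine draws_roundSelection (fun _ _ => rfl) ?_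
  rw [if_neg hc, middleRow, if_neg hc, hchains]
  simp [offColumn]

theorem isAdmissible_plainSelection (hc : ¬ Odd c) (hτ : τ = .so → ∀ t, flip t = true)
    (hself : ∀ t, flip t = true → 2 * t + 1 ∈ l →
      l.count (2 * t + 1) = 1 ∧ (2 * t + 2 ≤ c ↔ τ = .sp)) :
    (plainSelection c flip hflip).IsAdmissible l τ := by
  have hoff (x : ℕ) : offLength (fun _ => none) x = x := by simp [offLength, offColumn]
  refine isAdmissible_roundSelection (fun _ _ => rfl) hτ (fun t => Or.inl ⟨by simp, ?_⟩)
    fun t ht => ?_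
  · exact fun h => absurd h hc
  · simp only [hoff]
    by_cases hx : 2 * t + 1 ∈ l
    · obtain ⟨hcount, hcτ⟩ := hself t ht hx
      exact Or.inr ⟨2 * t + 1, hcount, fun _ _ => id, hcτ⟩
    · exact Or.inl fun x hxl => ne_of_mem_of_not_mem hxl hx

end Plain

/-- In the symplectic diagram of type (b), topmost vertices are joined to lowest ones unless the
central column is exhausted and a left column has exactly one vertex left. -/
def spFlip (l : List ℕ) (c t : ℕ) : Bool :=
  decide (2 * t + 2 ≤ c) || !decide (2 * t + 1 ∈ l)

theorem spFlip_eq_true {l : List ℕ} {c t : ℕ} (h : 2 * t + 2 ≤ c) : spFlip l c t = true := by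
  simp [spFlip, h]

theorem draws_oddSp (l : List ℕ) {c : ℕ} (hc : Even c) :
    (plainSelection c (spFlip l c) fun _ => spFlip_eq_true).Draws l .sp := by
  refine draws_plainSelection (Nat.not_odd_iff_even.2 hc) ?_
  refine congrArg (List.flatMap · _) (funext fun t => ?_)
  by_cases h : 2 * t + 2 ≤ c <;> by_cases hx : 2 * t + 1 ∈ l <;> simp [roundChains, spFlip, h, hx]

theorem isAdmissible_oddSp {l : List ℕ} {c : ℕ} (h : IsSimple .sp l (some c)) :
    (plainSelection c (spFlip l c) fun _ => spFlip_eq_true).IsAdmissible l .sp := by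
  refine isAdmissible_plainSelection (Nat.not_odd_iff_even.2 h.1) (by simp) fun t ht hx => ?_
  have htc : 2 * t + 2 ≤ c := by simpa [spFlip, hx] using ht
  have hcount := h.2 (2 * t + 1) (by simp [dimVector, hx]) ⟨t, rfl⟩ (by omega)
  have hne : c ≠ 2 * t + 1 := by omega
  simp only [dimVector, Option.toList_some, List.count_append, List.count_reverse,
    List.count_singleton, beq_iff_eq, if_neg hne] at hcount
  exact ⟨by omega, by simp [htc]⟩

theorem draws_oddSo_of_even (l : List ℕ) {c : ℕ} (hc : Even c) :
    (plainSelection c (fun _ => true) fun _ _ => rfl).Draws l .so := by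
  have hc' : ¬ Odd c := Nat.not_odd_iff_even.2 hc
  refine draws_plainSelection hc' ?_
  simp only [chains, oddSo, if_neg hc', oddSoRounds, List.length_range']
  rfl

theorem isAdmissible_oddSo_of_even {l : List ℕ} {c : ℕ} (h : IsSimple .so l (some c))
    (hc : Even c) : (plainSelection c (fun _ => true) fun _ _ => rfl).IsAdmissible l .so := by
  have hc' : ¬ Odd c := Nat.not_odd_iff_even.2 hc
  obtain ⟨e, o, rfl, he, -, -, -, ho⟩ := h
  refine isAdmissible_plainSelection hc' (fun _ _ => rfl) fun t _ hx => ?_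
  rw [ho.resolve_left hc', List.append_nil] at hx
  exact absurd ⟨t, rfl⟩ (Nat.not_odd_iff_even.2 (he _ hx))

/-! ## The chain through the middle of the central column -/

theorem spineRow_lt (l : List ℕ) (c x : ℕ) : ∀ j ∈ spineRow l c x, j < x := by
  intro j hj
  rw [Option.mem_def, spineRow] at hj
  split_ifs at hj with _ hx hx <;> obtain rfl := Option.some.inj hj
  · omega
  · have := hx.pos
    omega

section Spine

variable {l : List ℕ} {c : ℕ}

theorem isSome_spineRow {x : ℕ} : (spineRow l c x).isSome ↔
    if ∃ y ∈ l, Even y ∧ c < y then c < x else Odd x := by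
  rw [spineRow]
  split_ifs <;> simp_all

theorem offLength_spineRow (x : ℕ) :
    offLength (spineRow l c) x = if (spineRow l c x).isSome then x - 1 else x :=
  offLength_eq (spineRow_lt l c x)

theorem offSpine_eq_offColumn (v : List ℕ) :
    offSpine l c v = offColumn (spineRow l c v.length) v := by
  rw [offSpine]
  cases spineRow l c v.length <;> rfl

theorem draws_oddSo_of_odd (hc : Odd c) :
    (roundSelection c (spineRow l c) (spineRow_lt l c) (fun _ => true) fun _ _ => rfl).Draws l
      .so := by
  have hc' := Nat.odd_iff.1 hc
  have hmiddle : (List.range' (l.sum + 1) c)[c / 2]? = some (l.sum + 1 + c / 2) := by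
    rw [List.getElem?_range' (by omega), one_mul]
  have hlen : ((List.range' (l.sum + 1) c).eraseIdx (c / 2)).length = c - 1 := by
    rw [List.length_eraseIdx_of_lt (by rw [List.length_range']; omega), List.length_range']
  refine draws_roundSelection (fun h => absurd hc h) ?_
  simp only [chains, oddSo, if_pos hc, oddSoRounds, hmiddle, hlen, Option.toList_some,
    List.singleton_append, middleRow, offColumn, Option.elim_some]
  refine congrArg₂ _ rfl (congrArg (List.flatMap · _) (funext fun t => ?_))
  have hiff : 2 * t + 2 ≤ c - 1 ↔ 2 * t + 2 ≤ c := by omega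
  simp only [roundChains, hiff, if_true, funext offSpine_eq_offColumn, offColumn]

theorem IsSimple.even_lt_odd (h : IsSimple .so l (some c)) {x y : ℕ} (hx : x ∈ l) (hy : y ∈ l)
    (heven : Even x) (hodd : Odd y) : x < y := by
  obtain ⟨e, o, rfl, he, ho, heo, -, -⟩ := h
  have hxe : x ∈ e := (List.mem_append.1 hx).resolve_right fun hxo =>
    Nat.not_even_iff_odd.2 (ho x hxo) heven
  have hyo : y ∈ o := (List.mem_append.1 hy).resolve_left fun hye =>
    Nat.not_even_iff_odd.2 hodd (he y hye)
  exact heo x hxe y hyo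

theorem IsSimple.count_eq_one (h : IsSimple .so l (some c)) {x : ℕ} (hx : x ∈ l) (heven : Even x)
    (hcx : c < x) : l.count x = 1 := by
  obtain ⟨e, o, rfl, -, ho, -, hcount, -⟩ := h
  have hxo : x ∉ o := fun hxo => Nat.not_even_iff_odd.2 (ho x hxo) heven
  rw [List.count_append, hcount x ((List.mem_append.1 hx).resolve_right hxo) hcx,
    List.count_eq_zero.2 hxo]

theorem spine_nested_or_nested_spine (h : IsSimple .so l (some c)) (hc : Odd c) (t : ℕ) :
    ((∀ x ∈ l, (spineRow l c x).isSome → 2 * t + 2 ≤ offLength (spineRow l c) x) ∧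
        (Odd c → 2 * t + 2 ≤ c)) ∨
      ((∀ x ∈ l, 2 * t + 1 ≤ offLength (spineRow l c) x → (spineRow l c x).isSome) ∧
        (2 * t + 2 ≤ c → Odd c)) := by
  have hc' := Nat.odd_iff.1 hc
  simp only [offLength_spineRow, isSome_spineRow]
  by_cases hbig : ∃ y ∈ l, Even y ∧ c < y
  · simp only [if_pos hbig]
    obtain ⟨y, hy, heven, hcy⟩ := hbig
    have hodd_gt (x : ℕ) (hx : x ∈ l) (hodd : Odd x) : c < x :=
      hcy.trans (h.even_lt_odd hy hx heven hodd)
    by_cases ht : 2 * t + 2 ≤ c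
    · refine Or.inl ⟨fun x _ hx => ?_, fun _ => ht⟩
      rw [if_pos hx]
      omega
    · refine Or.inr ⟨fun x hx hxt => ?_, fun _ => hc⟩
      by_contra hcx
      rw [if_neg hcx] at hxt
      have := mt (hodd_gt x hx) hcx
      rw [Nat.odd_iff] at this
      omega
  · simp only [if_neg hbig]
    by_cases hx : ∃ x ∈ l, Even x ∧ 2 * t + 1 ≤ x
    · obtain ⟨x, hx, heven, hxt⟩ := hx
      have hxc : ¬ c < x := fun hcx => hbig ⟨x, hx, heven, hcx⟩
      have hx' := Nat.even_iff.1 heven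
      refine Or.inl ⟨fun y hy hodd => ?_, fun _ => by omega⟩
      have := h.even_lt_odd hx hy heven hodd
      rw [if_pos hodd]
      omega
    · refine Or.inr ⟨fun y hy hyt => ?_, fun _ => hc⟩
      by_contra hodd
      rw [if_neg hodd] at hyt
      exact hx ⟨y, hy, Nat.not_odd_iff_even.1 hodd, hyt⟩

theorem eq_of_offLength_spineRow_eq (h : IsSimple .so l (some c)) {x t : ℕ} (hx : x ∈ l)
    (hxt : offLength (spineRow l c) x = 2 * t + 1) :
    x = 2 * t + 2 ∧ c < x := by
  rw [offLength_spineRow] at hxt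
  simp only [isSome_spineRow] at hxt
  by_cases hbig : ∃ y ∈ l, Even y ∧ c < y
  · simp only [if_pos hbig] at hxt
    obtain ⟨y, hy, heven, hcy⟩ := hbig
    have hodd_gt (hodd : Odd x) : c < x := hcy.trans (h.even_lt_odd hy hx heven hodd)
    rw [Nat.odd_iff] at hodd_gt
    split_ifs at hxt <;> omega
  · simp only [if_neg hbig, Nat.odd_iff] at hxt
    split_ifs at hxt <;> omega

theorem isAdmissible_oddSo_of_odd (h : IsSimple .so l (some c)) (hc : Odd c) :
    (roundSelection c (spineRow l c) (spineRow_lt l c) (fun _ => true) fun _ _ => rfl).IsAdmissible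
      l .so := by
  refine isAdmissible_roundSelection (fun h => absurd hc h) (fun _ _ => rfl)
    (spine_nested_or_nested_spine h hc) fun t _ => ?_
  by_cases ht : 2 * t + 2 ∈ l ∧ c < 2 * t + 2
  · refine Or.inr ⟨2 * t + 2, h.count_eq_one ht.1 (by simp [parity_simps]) ht.2,
      fun x hx hne hxt => hne (eq_of_offLength_spineRow_eq h hx hxt).1, ?_⟩
    simp only [reduceCtorEq, iff_false]
    omega
  · refine Or.inl fun x hx hxt => ht ?_
    obtain ⟨rfl, hcx⟩ := eq_of_offLength_spineRow_eq h hx hxt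
    exact ⟨hx, hcx⟩

end Spine

theorem IsSimple.even_sum_dimVector {l : List ℕ} {c : Option ℕ} (h : IsSimple .sp l c) :
    Even (dimVector l c).sum := by
  rw [sum_dimVector]
  rcases c with _ | c
  · simp
  · exact (even_two_mul _).add h.1

theorem exists_rowSelection_of_isSimple {τ : Family} {l : List ℕ} {c : Option ℕ}
    (h : IsSimple τ l c) :
    ∃ (K : Type) (R : RowSelection c K), R.Draws l τ ∧ R.IsAdmissible l τ := by
  match τ, c, h with
  | .sp, none, _ => exact ⟨_, _, draws_evenSp l, isAdmissible_evenSp l⟩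
  | .sp, some _, h => exact ⟨_, _, draws_oddSp l h.1, isAdmissible_oddSp h⟩
  | .so, none, h => exact ⟨_, _, draws_evenSo l, isAdmissible_evenSo h⟩
  | .so, some c, h =>
    rcases c.even_or_odd with hc | hc
    · exact ⟨_, _, draws_oddSo_of_even l hc, isAdmissible_oddSo_of_even h hc⟩
    · exact ⟨_, _, draws_oddSo_of_odd hc, isAdmissible_oddSo_of_odd h hc⟩

end LineDiagram

theorem mainTheorem1 (τ : LineDiagram.Family) (l : List ℕ) (c : Option ℕ)
    (hpos : ∀ x ∈ LineDiagram.dimVector l c, 0 < x) (hsimple : LineDiagram.IsSimple τ l c) :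
    LineDiagram.IsRichardson τ (LineDiagram.dimVector l c) (LineDiagram.lineMatrix τ l c) ∧
      Module.finrank ℂ (LineDiagram.centralizer τ (LineDiagram.lineMatrix τ l c)) =
        Module.finrank ℂ (LineDiagram.leviFactor τ (LineDiagram.dimVector l c)) := by
  obtain ⟨K, R, hdraws, hadmissible⟩ := LineDiagram.exists_rowSelection_of_isSimple hsimple
  refine hadmissible.isAdmissible_chainSystem.isRichardson_lineMatrix ?_ fun _ _ =>
    hdraws.mem_diagramLines_iff
  rintro rfl
  exact hsimple.even_sum_dimVector
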